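/- Conventions. A real algebraic set is the set $X\subset\mathbb R^n$ of common real zeros of a set of real polynomials; $\mathrm{Pol}(X)$ is the ring of polynomial functions on $X$ and $K(X)$ its total ring of fractions. A polynomial map $\pi:Y\to X$ of real algebraic sets is *finite* if $f\mapsto f\circ\pi$ makes $\mathrm{Pol}(Y)$ a finitely generated $\mathrm{Pol}(X)$-module, and *birational* if $f\mapsto f\circ\pi$ maps non-zero-divisors to non-zero-divisors and induces an isomorphism $K(X)\to K(Y)$. Let $\mathrm{Pol}(X)'$ be the integral closure of $\mathrm{Pol}(X)$ in $K(X)$, let $X_{\mathbb C}$ and $X'_{\mathbb C}$ be the complex algebraic sets with rings $\mathrm{Pol}(X)\otimes_{\mathbb R}\mathbb C$ and $\mathrm{Pol}(X)'\otimes_{\mathbb R}\mathbb C$ (so that their points are the $\mathbb R$-algebra morphisms from $\mathrm{Pol}(X)$, respectively $\mathrm{Pol}(X)'$, to $\mathbb C$), let $X'\subset X'_{\mathbb C}$ be the set of real points, and let $\pi'_{\mathbb C}:X'_{\mathbb C}\to X_{\mathbb C}$ be the map induced by $\mathrm{Pol}(X)\subset\mathrm{Pol}(X)'$. One says that $X$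 has a *totally real normalization* if $\pi_{\mathbb C}'^{-1}(X)=X'$. The closed sets of the *constructible topology* of $X$ are the Zariski constructible subsets of $X$ that are closed for the Euclidean topology. An ideal $I$ of a ring is *real* if $a_1^2+\dots+a_k^2\in I$ implies $a_1,\dots,a_k\in I$. **Theorem.** Let $X\subset\mathbb R^n$ be a real algebraic set with a totally real normalization, let $Y\subset\mathbb R^m$ be a real algebraic set, and let $\pi:Y\to X$ be a bijective finite birational polynomial map. Then: 1. $\pi$ is a homeomorphism for the Euclidean, the constructible and the Zariski topologies. 2. The map $\mathfrak q\mapsto\{f\in\mathrm{Pol}(X): f\circ\pi\in\mathfrak q\}$ is a bijection from the set of real prime ideals of $\mathrm{Pol}(Y)$ onto the set of real prime ideals of $\mathrm{Pol}(X)$. 3. $\pi$ is hereditarily birational: for every irreducible algebraic subset $W\subset Y$, with $V$ the Zariski closure of $\pi(W)$, the restriction $\pi_{|W}:W\to V$ is birational. -/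

import Mathlib

open scoped Topology

noncomputable section

namespace RealAlg

/-! ## Real algebraic sets and the Zariski topology -/

/-- The set of common zeros in `ℝⁿ` of a set of polynomials. -/
def zeroSet {n : ℕ} (S : Set (MvPolynomial (Fin n) ℝ)) : Set (Fin n → ℝ) :=
  {x | ∀ p ∈ S, MvPolynomial.eval x p = 0}

/-- A real algebraic set: the set of common zeros in `ℝⁿ` of some set of real polynomials. -/
def IsAlgebraicSet {n : ℕ} (X : Set (Fin n → ℝ)) : Prop :=
  ∃ S : Set (MvPolynomial (Fin n) ℝ), X = zeroSet S

lemma isAlgebraicSet_empty {n : ℕ} : IsAlgebraicSet (∅ : Set (Fin n → ℝ)) :=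
  ⟨{1}, by ext x; simp [zeroSet]⟩

lemma IsAlgebraicSet.sInter {n : ℕ} {T : Set (Set (Fin n → ℝ))}
    (hT : ∀ X ∈ T, IsAlgebraicSet X) : IsAlgebraicSet (⋂₀ T) := by
  refine ⟨{p | ∃ X ∈ T, ∀ x ∈ X, MvPolynomial.eval x p = 0}, ?_⟩
  ext x
  constructor
  · rintro hx p ⟨X, hX, hp⟩
    exact hp x (hx X hX)
  · intro hx X hX
    obtain ⟨S, hS⟩ := hT X hX
    rw [hS]
    intro p hp
    refine hx p ⟨X, hX, fun y hy => ?_⟩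
    rw [hS] at hy
    exact hy p hp

lemma IsAlgebraicSet.union {n : ℕ} {X Y : Set (Fin n → ℝ)}
    (hX : IsAlgebraicSet X) (hY : IsAlgebraicSet Y) : IsAlgebraicSet (X ∪ Y) := by
  obtain ⟨S, rfl⟩ := hX
  obtain ⟨T, rfl⟩ := hY
  refine ⟨{r | ∃ p ∈ S, ∃ q ∈ T, r = p * q}, ?_⟩
  ext x
  constructor
  · rintro (hx | hx) r ⟨p, hp, q, hq, rfl⟩
    · rw [map_mul, hx p hp, zero_mul]
    · rw [map_mul, hx q hq, mul_zero]
  · intro hx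
    by_contra hcon
    rw [Set.mem_union, not_or] at hcon
    obtain ⟨h1, h2⟩ := hcon
    simp only [zeroSet, Set.mem_ofPred_eq, not_forall] at h1 h2
    obtain ⟨p, hp, hpx⟩ := h1
    obtain ⟨q, hq, hqx⟩ := h2
    have h := hx (p * q) ⟨p, hp, q, hq, rfl⟩
    rw [map_mul] at h
    exact (mul_ne_zero hpx hqx) h

/-- The Zariski topology of `ℝⁿ`: the closed sets are the real algebraic sets. -/
@[reducible] def zariski (n : ℕ) : TopologicalSpace (Fin n → ℝ) :=
  TopologicalSpace.ofClosed {X | IsAlgebraicSet X} isAlgebraicSet_empty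
    (fun _ hT => IsAlgebraicSet.sInter fun _ hX => hT hX)
    (fun _ hX _ hY => IsAlgebraicSet.union hX hY)

/-- The Zariski topology of a subset `X` of `ℝⁿ`, induced by the one of `ℝⁿ`. -/
@[reducible] def zariskiOn {n : ℕ} (X : Set (Fin n → ℝ)) : TopologicalSpace X :=
  TopologicalSpace.induced Subtype.val (zariski n)

/-- An irreducible algebraic set: a (nonempty) algebraic set that is irreducible for the Zariski
topology. -/
def IsIrreducibleAlgebraicSet {n : ℕ} (W : Set (Fin n → ℝ)) : Prop :=
  IsAlgebraicSet W ∧ @IsIrreducible _ (zariski n) W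

/-- The Zariski closure in `ℝⁿ` of a subset of `ℝⁿ`. -/
def zariskiClosure {n : ℕ} (S : Set (Fin n → ℝ)) : Set (Fin n → ℝ) :=
  @closure _ (zariski n) S

/-! ## The constructible topology -/

/-- Zariski constructible subsets of `X`: finite unions of differences of Zariski closed
subsets. -/
def IsZariskiConstructible {n : ℕ} {X : Set (Fin n → ℝ)} (S : Set X) : Prop :=
  ∃ (k : ℕ) (F G : Fin k → Set X),
    (∀ i, IsClosed[zariskiOn X] (F i)) ∧ (∀ i, IsClosed[zariskiOn X] (G i)) ∧
      S = ⋃ i, F i \ G i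

/-- The closed sets of the constructible topology: the Zariski constructible sets that are closed
for the Euclidean topology. -/
def IsConstructibleClosed {n : ℕ} {X : Set (Fin n → ℝ)} (S : Set X) : Prop :=
  IsZariskiConstructible S ∧ IsClosed S

/-- The constructible topology on `X`: the coarsest topology for which the Euclidean closed
Zariski constructible subsets of `X` are closed. -/
@[reducible] def constructibleOn {n : ℕ} (X : Set (Fin n → ℝ)) : TopologicalSpace X :=
  TopologicalSpace.generateFrom {U | IsConstructibleClosed Uᶜ}

/-! ## Polynomial functions and polynomial maps -/

/-- The `ℝ`-algebra of polynomial functions on a subset `X` of `ℝⁿ`, as an algebra of functions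
`X → ℝ`. -/
def Pol {n : ℕ} (X : Set (Fin n → ℝ)) : Subalgebra ℝ (X → ℝ) :=
  (MvPolynomial.aeval fun (i : Fin n) (x : X) => x.1 i :
    MvPolynomial (Fin n) ℝ →ₐ[ℝ] (X → ℝ)).range

lemma aeval_coord_apply {n : ℕ} (X : Set (Fin n → ℝ)) (p : MvPolynomial (Fin n) ℝ) (x : X) :
    (MvPolynomial.aeval fun (i : Fin n) (x : X) => x.1 i : _ →ₐ[ℝ] (X → ℝ)) p x =
      MvPolynomial.eval x.1 p := by
  have h : (Pi.evalAlgHom ℝ (fun _ : X => ℝ) x).comp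
      (MvPolynomial.aeval fun (i : Fin n) (x : X) => x.1 i) = MvPolynomial.aeval x.1 := by
    ext i
    simp
  exact DFunLike.congr_fun h p

/-- A function belongs to `Pol X` iff it is the restriction to `X` of a polynomial. -/
lemma mem_Pol_iff {n : ℕ} {X : Set (Fin n → ℝ)} {f : X → ℝ} :
    f ∈ Pol X ↔ ∃ p : MvPolynomial (Fin n) ℝ, ∀ x : X, f x = MvPolynomial.eval x.1 p := by
  constructor
  · rintro ⟨p, rfl⟩
    exact ⟨p, fun x => aeval_coord_apply X p x⟩
  · rintro ⟨p, hp⟩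
    exact ⟨p, funext fun x => (aeval_coord_apply X p x).trans (hp x).symm⟩

/-- A polynomial map `Y → X`: its coordinate functions are polynomial functions on `Y`. -/
structure PolynomialMap {m n : ℕ} (Y : Set (Fin m → ℝ)) (X : Set (Fin n → ℝ)) where
  toFun : Y → X
  polynomial : ∀ i : Fin n, (fun y => (toFun y).1 i) ∈ Pol Y

namespace PolynomialMap

variable {m n : ℕ} {Y : Set (Fin m → ℝ)} {X : Set (Fin n → ℝ)}

lemma comp_mem_Pol (φ : PolynomialMap Y X) {f : X → ℝ} (hf : f ∈ Pol X) :
    f ∘ φ.toFun ∈ Pol Y := by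
  obtain ⟨p, hp⟩ := mem_Pol_iff.1 hf
  have h : f ∘ φ.toFun = MvPolynomial.aeval (fun i (y : Y) => (φ.toFun y).1 i) p := by
    funext y
    have h' : (Pi.evalAlgHom ℝ (fun _ : Y => ℝ) y).comp
        (MvPolynomial.aeval fun (i : Fin n) (y : Y) => (φ.toFun y).1 i) =
          MvPolynomial.aeval (φ.toFun y).1 := by
      ext i
      simp
    exact (hp (φ.toFun y)).trans (DFunLike.congr_fun h' p).symm
  rw [h]
  exact (MvPolynomial.aeval_range (R := ℝ) (fun i (y : Y) => (φ.toFun y).1 i)).trans_le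
    (Algebra.adjoin_le (by rintro _ ⟨i, rfl⟩; exact φ.polynomial i)) ⟨p, rfl⟩

/-- The `ℝ`-algebra morphism `Pol X → Pol Y`, `f ↦ f ∘ φ`, induced by a polynomial map. -/
def pullback (φ : PolynomialMap Y X) : Pol X →ₐ[ℝ] Pol Y where
  toFun f := ⟨f.1 ∘ φ.toFun, φ.comp_mem_Pol f.2⟩
  map_one' := rfl
  map_mul' _ _ := rfl
  map_zero' := rfl
  map_add' _ _ := rfl
  commutes' _ := rfl

/-- `φ : Y → X` is finite: `Pol Y` is a finitely generated `Pol X`-module. -/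
def IsFinite (φ : PolynomialMap Y X) : Prop :=
  φ.pullback.toRingHom.Finite

end PolynomialMap

/-- A ring morphism `A → B` induces an isomorphism between the total rings of fractions: it maps
non-zero-divisors to non-zero-divisors and the induced morphism is bijective. -/
def InducesFractionIso {A B : Type*} [CommRing A] [CommRing B] (f : A →+* B) : Prop :=
  ∃ h : nonZeroDivisors A ≤ (nonZeroDivisors B).comap f,
    Function.Bijective
      (IsLocalization.map (FractionRing B) f h : FractionRing A →+* FractionRing B)

namespace PolynomialMap

variable {m n : ℕ} {Y : Set (Fin m → ℝ)} {X : Set (Fin n → ℝ)}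

/-- `φ : Y → X` is birational: it induces an isomorphism from the total ring of fractions `K(X)`
of `Pol X` onto the total ring of fractions `K(Y)` of `Pol Y`. -/
def IsBirational (φ : PolynomialMap Y X) : Prop :=
  InducesFractionIso φ.pullback.toRingHom

/-- The Zariski closure of the image `φ(W)` of a subset `W ⊆ Y`. -/
def imageClosure (φ : PolynomialMap Y X) {W : Set (Fin m → ℝ)} (hW : W ⊆ Y) :
    Set (Fin n → ℝ) :=
  zariskiClosure (Set.range fun w : W => (φ.toFun ⟨w.1, hW w.2⟩).1)

/-- The restriction of `φ : Y → X` to `W ⊆ Y`, as a polynomial map from `W` to the Zariski closure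
of `φ(W)`. -/
def restrict (φ : PolynomialMap Y X) {W : Set (Fin m → ℝ)} (hW : W ⊆ Y) :
    PolynomialMap W (φ.imageClosure hW) where
  toFun w := ⟨(φ.toFun ⟨w.1, hW w.2⟩).1, @subset_closure _ (zariski n) _ _ ⟨w, rfl⟩⟩
  polynomial i := by
    obtain ⟨p, hp⟩ := mem_Pol_iff.1 (φ.polynomial i)
    exact mem_Pol_iff.2 ⟨p, fun w => hp ⟨w.1, hW w.2⟩⟩

/-- `φ : Y → X` is hereditarily birational: for every irreducible algebraic subset `W` of `Y`, the
restriction of `φ` from `W` to the Zariski closure of `φ(W)` is birational. -/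
def IsHereditarilyBirational (φ : PolynomialMap Y X) : Prop :=
  ∀ (W : Set (Fin m → ℝ)) (hW : W ⊆ Y), IsIrreducibleAlgebraicSet W →
    (φ.restrict hW).IsBirational

end PolynomialMap

/-! ## Totally real normalization -/

/-- The points of the complex algebraic set whose ring of polynomial functions is `A ⊗[ℝ] ℂ`: the
`ℂ`-algebra morphisms `A ⊗[ℝ] ℂ → ℂ`, that is, the `ℝ`-algebra morphisms `A → ℂ`. -/
abbrev ComplexPoint (A : Type*) [CommRing A] [Algebra ℝ A] : Type _ := A →ₐ[ℝ] ℂ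

/-- The real points among the complex points: those with values in `ℝ`. -/
def realPoints (A : Type*) [CommRing A] [Algebra ℝ A] : Set (ComplexPoint A) :=
  {φ | ∀ a, (φ a).im = 0}

/-- The complex point of `X_ℂ` given by a point `x` of `X`: evaluation at `x`. -/
def evalPoint {n : ℕ} {X : Set (Fin n → ℝ)} (x : X) : ComplexPoint (Pol X) :=
  (Algebra.ofId ℝ ℂ).comp ((Pi.evalAlgHom ℝ (fun _ : X => ℝ) x).comp (Pol X).val)

/-- The integral closure of a ring in its total ring of fractions. For `A = Pol X` this is the ring
`Pol X'` of polynomial functions on the normalization `X'` of `X`. -/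
abbrev Normalization (A : Type*) [CommRing A] : Type _ :=
  integralClosure A (FractionRing A)

/-- The `ℝ`-algebra structure of the integral closure of an `ℝ`-algebra. -/
instance instAlgebraNormalization (A : Type*) [CommRing A] [Algebra ℝ A] :
    Algebra ℝ (Normalization A) :=
  inferInstance

/-- The morphism `X'_ℂ → X_ℂ` induced by the inclusion `A → A'` of a ring into its integral
closure: restriction to `A` of morphisms `A' → ℂ`. -/
def complexNormalizationMap (A : Type*) [CommRing A] [Algebra ℝ A] :
    ComplexPoint (Normalization A) → ComplexPoint A :=
  fun φ => φ.comp (IsScalarTower.toAlgHom ℝ A (Normalization A))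

/-- `X` has a totally real normalization: the inverse image of `X ⊆ X_ℂ` under the complexified
normalization map `X'_ℂ → X_ℂ` is the set `X'` of real points of `X'_ℂ`. -/
def HasTotallyRealNormalization {n : ℕ} (X : Set (Fin n → ℝ)) : Prop :=
  complexNormalizationMap (Pol X) ⁻¹' Set.range (evalPoint (X := X)) =
    realPoints (Normalization (Pol X))

/-! ## Real prime ideals -/

/-- An ideal is real if `a₁² + ⋯ + aₖ² ∈ I` implies that all `aᵢ` belong to `I`. -/
def IsRealIdeal {A : Type*} [CommRing A] (I : Ideal A) : Prop :=
  ∀ (k : ℕ) (a : Fin k → A), ∑ i, a i ^ 2 ∈ I → ∀ i, a i ∈ I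

/-- The real prime spectrum of a ring: its set of real prime ideals. -/
def realSpec (A : Type*) [CommRing A] : Set (PrimeSpectrum A) :=
  {p | IsRealIdeal p.asIdeal}

end RealAlg

end

/-! ## Ordered fields with the intermediate value property for polynomials -/

/-! The crux: if `X` has a totally real normalization, every complex point of `Y` over a point `x`
of `X` is real. Birationality and integrality embed `Pol Y` in the integral closure of `Pol X`. A
morphism `Pol Y → ℂ` over `x` extends to that closure by lying over, is real there by hypothesis,
and is therefore evaluation at a point of `Y` above `x` (`PolynomialMap.exists_point`). Lying over a
prescribed ideal gives `PolynomialMap.exists_point_of_comap_le`: zeros of the contraction of an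
ideal lift to zeros of the ideal. Hence images of Zariski closed sets are Zariski closed. For the
Euclidean topology finiteness already gives properness, because roots of a monic polynomial are
bounded in terms of its coefficients; the constructible case combines the two.

For hereditary birationality, injectivity leaves at most one complex point of `W` over each point of
`V`. Up to a denominator, `b` in `Pol W` has a monic annihilator `h` of degree `d` dividing all the
others. At each point of `V` the specialization of `h` has a single complex root, so it is the
`d`-th power of a linear polynomial. Points of `V` separate `Pol V`, so `d ^ d * h = (d X + c) ^ d`
over `Pol V`, which makes `b` a fraction (`RingHom.IsIntegral.exists_mul_eq`).

For real primes, a prime `Q` over a real prime `P` is contained in the vanishing ideal of the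
preimage of the zero set of `P`. By the real Nullstellensatz that ideal also contracts to `P`, and
incomparability in integral extensions forces equality (`PolynomialMap.eq_vanishingIdeal`). So `Q`
is determined by `P`, and is real.

The real Nullstellensatz rests on Artin–Lang specialization (`exists_eval_eq_zero_and_ne_zero`).
Zorn's lemma embeds a semireal field in an ordered field with the intermediate value property for
polynomials (`exists_ringHom_polyIVT`). Cohen–Hörmander sign tables transfer sign conditions in one
variable between two such fields (`exists_forall_sign_eval₂_eq`). With an ultrapower of `ℝ` as
target, this brings coordinates down to `ℝ` one at a time (`HasRealSignApproximations.eval₂`). -/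

noncomputable section

open Polynomial

/-- An ordered field whose polynomials satisfy the intermediate value theorem. -/
class PolyIVT (K : Type*) [Field K] [LinearOrder K] : Prop where
  exists_root_of_neg_of_pos : ∀ (p : K[X]) {a b : K}, a < b → p.eval a < 0 → 0 < p.eval b →
    ∃ c, a < c ∧ c < b ∧ p.eval c = 0

namespace PolyIVT

variable {K : Type*} [Field K] [LinearOrder K] [IsStrictOrderedRing K]

instance : PolyIVT ℝ where
  exists_root_of_neg_of_pos p a b hab ha hb := by
    obtain ⟨c, hc, hc'⟩ := intermediate_value_Ioo hab.le p.continuous.continuousOn ⟨ha, hb⟩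
    exact ⟨c, hc.1, hc.2, hc'⟩

theorem exists_root_of_mul_neg [PolyIVT K] (p : K[X]) {a b : K} (hab : a < b)
    (h : p.eval a * p.eval b < 0) : ∃ c, a < c ∧ c < b ∧ p.eval c = 0 := by
  rcases mul_neg_iff.1 h with ⟨ha, hb⟩ | ⟨ha, hb⟩
  · obtain ⟨c, h1, h2, h3⟩ := exists_root_of_neg_of_pos (-p) hab (by simpa using ha)
      (by simpa using hb)
    exact ⟨c, h1, h2, by simpa using h3⟩
  · exact exists_root_of_neg_of_pos p hab ha hb

theorem exists_eval_eq [PolyIVT K] (p : K[X]) {a b v : K} (hab : a < b)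
    (h : (p.eval a - v) * (p.eval b - v) < 0) : ∃ c, a < c ∧ c < b ∧ p.eval c = v := by
  obtain ⟨c, h1, h2, h3⟩ := exists_root_of_mul_neg (p - C v) hab (by simpa using h)
  exact ⟨c, h1, h2, by simpa [sub_eq_zero] using h3⟩

/-- Divide out the full multiplicities `m`, `n` of `a` and `b`. The cofactor `q` keeps its sign on
`[a, b]`, and what remains of the derivative after removing the powers `m - 1`, `n - 1` changes sign
there. -/
theorem exists_derivative_eq_zero_of_consecutive_roots [PolyIVT K] {p : K[X]} (hp : p ≠ 0)
    {a b : K} (hab : a < b) (ha : p.eval a = 0) (hb : p.eval b = 0)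
    (hc : ∀ c, a < c → c < b → p.eval c ≠ 0) :
    ∃ c, a < c ∧ c < b ∧ (derivative p).eval c = 0 := by
  obtain ⟨q₁, h₁, h₁'⟩ := p.exists_eq_pow_rootMultiplicity_mul_and_not_dvd hp a
  set m := p.rootMultiplicity a with hm
  have hq₁ : q₁ ≠ 0 := by rintro rfl; simp at h₁'
  obtain ⟨q, h₂, h₂'⟩ := q₁.exists_eq_pow_rootMultiplicity_mul_and_not_dvd hq₁ b
  set n := q₁.rootMultiplicity b with hn
  have hm0 : 0 < m := (rootMultiplicity_pos hp).2 ha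
  have hn0 : 0 < n := by
    refine (rootMultiplicity_pos hq₁).2 ?_
    rw [h₁] at hb
    simpa [sub_eq_zero, hab.ne', hm0.ne'] using hb
  have hqa : q.eval a ≠ 0 := by
    intro h
    exact h₁' (by rw [h₂]; exact (dvd_iff_isRoot.2 h).mul_left _)
  have hqb : q.eval b ≠ 0 := fun h => h₂' (dvd_iff_isRoot.2 h)
  have hpq : p = (X - C a) ^ m * ((X - C b) ^ n * q) := by rw [← h₂]; exact h₁
  have hqc : 0 < q.eval a * q.eval b := by
    by_contra h
    obtain ⟨c, h1, h2, h3⟩ := exists_root_of_mul_neg q hab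
      (lt_of_le_of_ne (not_lt.1 h) (mul_ne_zero hqa hqb))
    exact hc c h1 h2 (by rw [hpq]; simp [h3])
  obtain ⟨m', hm'⟩ : ∃ m', m = m' + 1 := ⟨m - 1, by omega⟩
  obtain ⟨n', hn'⟩ : ∃ n', n = n' + 1 := ⟨n - 1, by omega⟩
  -- At `a` only the first summand survives, at `b` only the second; the factors `a - b` and `b - a`
  -- give opposite signs.
  let r : K[X] := C (m : K) * (X - C b) * q + C (n : K) * (X - C a) * q
    + (X - C a) * (X - C b) * derivative q
  have hder : derivative p = (X - C a) ^ m' * (X - C b) ^ n' * r := by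
    rw [hpq, hm', hn']
    simp only [derivative_mul, derivative_X_sub_C_pow, r, hm', hn']
    simp only [Nat.add_sub_cancel]
    push_cast
    ring
  have hra : r.eval a * r.eval b < 0 := by
    have h1 : r.eval a * r.eval b
        = -((m : K) * n * (b - a) ^ 2 * (q.eval a * q.eval b)) := by
      simp only [r]
      simp
      ring
    rw [h1]
    have : (0:K) < b - a := sub_pos.2 hab
    have h2 : (0:K) < m := by exact_mod_cast hm0
    have h3 : (0:K) < n := by exact_mod_cast hn0
    have := mul_pos (mul_pos (mul_pos h2 h3) (pow_pos this 2)) hqc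
    linarith
  obtain ⟨c, h1, h2, h3⟩ := exists_root_of_mul_neg r hab hra
  exact ⟨c, h1, h2, by rw [hder]; simp [h3]⟩

/-- Rolle's theorem. -/
theorem exists_derivative_eq_zero [PolyIVT K] (p : K[X])
    {a b : K} (hab : a < b) (ha : p.eval a = 0) (hb : p.eval b = 0) :
    ∃ c, a < c ∧ c < b ∧ (derivative p).eval c = 0 := by
  by_cases hp : p = 0
  · obtain ⟨c, h1, h2⟩ := exists_between hab
    exact ⟨c, h1, h2, by simp [hp]⟩
  let s := p.roots.toFinset.filter (fun c => a < c)
  have hs : s.Nonempty := ⟨b, by simp [s, hp, hab, hb]⟩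
  have hmem := s.min'_mem hs
  simp only [s, Finset.mem_filter, Multiset.mem_toFinset, mem_roots hp, IsRoot.def] at hmem
  have hle : s.min' hs ≤ b := s.min'_le b (by simp [s, hp, hab, hb])
  obtain ⟨c, h1, h2, h3⟩ := exists_derivative_eq_zero_of_consecutive_roots hp hmem.2 ha hmem.1
    (fun c h1 h2 h3 => (s.min'_le c (by simp [s, hp, h1, h3])).not_gt h2)
  exact ⟨c, h1, h2.trans_le hle, h3⟩

/-- The mean value theorem. -/
theorem exists_eval_sub_eq [PolyIVT K] (p : K[X]) {a b : K} (hab : a < b) :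
    ∃ c, a < c ∧ c < b ∧ p.eval b - p.eval a = (derivative p).eval c * (b - a) := by
  have hba : b - a ≠ 0 := (sub_pos.2 hab).ne'
  -- The graph minus its chord, multiplied by `b - a` to avoid a division.
  obtain ⟨c, h1, h2, h3⟩ := exists_derivative_eq_zero
    (C (b - a) * (p - C (p.eval a)) - C (p.eval b - p.eval a) * (X - C a)) hab
    (by simp) (by simp; ring)
  refine ⟨c, h1, h2, ?_⟩
  simp [sub_eq_zero] at h3
  linear_combination -h3

end PolyIVT

/-! ### Signs of polynomials near infinity. -/

section Infinity

variable {K : Type*} [Field K] [LinearOrder K] [IsStrictOrderedRing K]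

/-- Induction through `p = divX * X + p(0)`: the uniform bound `ε` for `divX` is what lets the
product with `x` outgrow `|p(0)|`. -/
theorem Polynomial.exists_forall_ge_le_eval (n : ℕ) : ∀ (p : K[X]), p.natDegree = n →
    0 < p.leadingCoeff → ∃ M ε : K, 0 < ε ∧ ∀ x, M ≤ x → ε ≤ p.eval x := by
  induction n with
  | zero =>
    intro p hp h
    rw [eq_C_of_natDegree_eq_zero hp] at h ⊢
    exact ⟨0, p.coeff 0, by simpa using h, by simp⟩
  | succ n ih =>
    intro p hp h
    have hdeg : p.divX.natDegree = n := by rw [natDegree_divX_eq_natDegree_tsub_one, hp]; rfl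
    obtain ⟨M, ε, hε, hM⟩ := ih p.divX hdeg (by
      rw [leadingCoeff, hdeg, coeff_divX, ← hp]; exact h)
    refine ⟨max (max M 0) ((|p.coeff 0| + 1) / ε), 1, one_pos, fun x hx => ?_⟩
    simp only [max_le_iff] at hx
    obtain ⟨⟨h1, h2⟩, h3⟩ := hx
    rw [div_le_iff₀ hε] at h3
    have h4 := mul_le_mul_of_nonneg_left (hM x h1) h2
    have h5 := neg_abs_le (p.coeff 0)
    rw [← divX_mul_X_add p]
    simp only [eval_add, eval_mul, eval_X, eval_C]
    linarith [mul_comm x (p.divX.eval x)]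

theorem Polynomial.exists_forall_ge_sign_eval (p : K[X]) : ∃ M : K, ∀ x, M ≤ x →
    SignType.sign (p.eval x) = SignType.sign p.leadingCoeff := by
  rcases lt_trichotomy p.leadingCoeff 0 with h | h | h
  · obtain ⟨M, ε, hε, hM⟩ := exists_forall_ge_le_eval _ (-p) rfl (by simpa using h)
    refine ⟨M, fun x hx => ?_⟩
    have := hM x hx
    rw [sign_neg h, sign_neg]
    simp at this
    linarith
  · exact ⟨0, by simp [leadingCoeff_eq_zero.1 h]⟩
  · obtain ⟨M, ε, hε, hM⟩ := exists_forall_ge_le_eval _ p rfl h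
    refine ⟨M, fun x hx => ?_⟩
    rw [sign_pos h, sign_pos (hε.trans_le (hM x hx))]

/-- A nonconstant polynomial with positive derivative near infinity is positive there. -/
theorem Polynomial.exists_gt_eval_pos {p : K[X]} (z : K)
    (h : ∀ w, z < w → 0 < (derivative p).eval w) : ∃ w, z < w ∧ 0 < p.eval w := by
  obtain ⟨M, hM⟩ := p.exists_forall_ge_sign_eval
  obtain ⟨M', hM'⟩ := (derivative p).exists_forall_ge_sign_eval
  set w := max (max M M') (z + 1)
  have hzw : z < w := (lt_add_one z).trans_le (le_max_right _ _)
  refine ⟨w, hzw, ?_⟩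
  have h1 := hM w ((le_max_left _ _).trans (le_max_left _ _))
  have h2 := hM' w ((le_max_right _ _).trans (le_max_left _ _))
  rw [sign_pos (h w hzw), eq_comm, sign_eq_one_iff] at h2
  rw [← sign_eq_one_iff, h1, sign_eq_one_iff]
  -- In characteristic zero the leading coefficient of the derivative being positive makes that of
  -- `p` positive.
  have h3 : (derivative p).leadingCoeff = p.leadingCoeff * p.natDegree := by
    simp
  rw [h3] at h2
  exact pos_of_mul_pos_left h2 (Nat.cast_nonneg _)

end Infinity
end

/-! ## Comparison of two polynomials over two ordered fields -/

noncomputable section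

open Polynomial Order

section SamePosition

variable {K L : Type*} [LinearOrder K] [LinearOrder L]

/-- `y` and `z` have the same position with respect to the points matched by `G`. -/
def SamePosition (G : PartialIso K L) (y : K) (z : L) : Prop :=
  ∀ g ∈ G.1, cmp g.1 y = cmp g.2 z

namespace SamePosition

variable {G : PartialIso K L} {y y₁ y₂ : K} {z z₁ z₂ : L}

theorem lt_iff (h : SamePosition G y z) {g : K × L} (hg : g ∈ G.1) : g.1 < y ↔ g.2 < z :=
  lt_iff_lt_of_cmp_eq_cmp (h g hg)

theorem gt_iff (h : SamePosition G y z) {g : K × L} (hg : g ∈ G.1) : y < g.1 ↔ z < g.2 :=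
  lt_iff_lt_of_cmp_eq_cmp (by rw [← cmp_swap, h g hg, cmp_swap])

theorem eq_iff (h : SamePosition G y z) {g : K × L} (hg : g ∈ G.1) : g.1 = y ↔ g.2 = z :=
  eq_iff_eq_of_cmp_eq_cmp (h g hg)

theorem mk (h₁ : ∀ g ∈ G.1, g.1 < y ↔ g.2 < z) (h₂ : ∀ g ∈ G.1, y < g.1 ↔ z < g.2) :
    SamePosition G y z := by
  intro g hg
  have h₁ := h₁ g hg
  have h₂ := h₂ g hg
  rcases lt_trichotomy g.1 y with h | h | h
  · rw [cmp_eq_lt_iff _ _ |>.2 h, eq_comm, cmp_eq_lt_iff]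
    exact h₁.1 h
  · rw [cmp_eq_eq_iff _ _ |>.2 h, eq_comm, cmp_eq_eq_iff]
    exact le_antisymm (not_lt.1 (mt h₂.2 (by simp [h]))) (not_lt.1 (mt h₁.2 (by simp [h])))
  · rw [cmp_eq_gt_iff _ _ |>.2 h, eq_comm, cmp_eq_gt_iff]
    exact h₂.1 h

theorem congr (h₁ : SamePosition G y₁ z₁) (h₂ : SamePosition G y₁ z₂)
    (h₃ : SamePosition G y₂ z₂) : SamePosition G y₂ z₁ :=
  fun g hg => (h₃ g hg).trans ((h₂ g hg).symm.trans (h₁ g hg))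

theorem comm (h : SamePosition G y z) : SamePosition G.comm z y := by
  intro g hg
  obtain ⟨g', hg', rfl⟩ := Finset.mem_image.1 hg
  exact (h g' hg').symm

/-- The points in a given position form a convex set. The `min`/`max` form avoids ordering `y₁` and
`y₂`. -/
theorem of_between (h₁ : SamePosition G y₁ z) (h₂ : SamePosition G y₂ z) {c : K}
    (hc₁ : min y₁ y₂ ≤ c) (hc₂ : c ≤ max y₁ y₂) : SamePosition G c z := by
  refine mk (fun g hg => ⟨fun h => ?_, fun h => ?_⟩) (fun g hg => ⟨fun h => ?_, fun h => ?_⟩)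
  · rcases lt_max_iff.1 (h.trans_le hc₂) with h | h
    · exact (h₁.lt_iff hg).1 h
    · exact (h₂.lt_iff hg).1 h
  · exact (lt_min ((h₁.lt_iff hg).2 h) ((h₂.lt_iff hg).2 h)).trans_le hc₁
  · rcases min_lt_iff.1 (hc₁.trans_lt h) with h | h
    · exact (h₁.gt_iff hg).1 h
    · exact (h₂.gt_iff hg).1 h
  · exact hc₂.trans_lt (max_lt ((h₁.gt_iff hg).2 h) ((h₂.gt_iff hg).2 h))

end SamePosition

theorem mem_comm_iff {G : PartialIso K L} {g : L × K} : g ∈ G.comm.1 ↔ (g.2, g.1) ∈ G.1 := by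
  constructor
  · intro hg
    obtain ⟨g', hg', rfl⟩ := Finset.mem_image.1 hg
    exact hg'
  · intro hg
    exact Finset.mem_image.2 ⟨_, hg, rfl⟩

theorem comm_comm (G : PartialIso K L) : G.comm.comm = G := by
  apply Subtype.ext
  ext g
  rw [mem_comm_iff, mem_comm_iff]

theorem SamePosition.of_comm {G : PartialIso K L} {y : K} {z : L}
    (h : SamePosition G.comm z y) : SamePosition G y z := by
  have := h.comm
  rwa [comm_comm] at this

theorem SamePosition.of_between_right {G : PartialIso K L} {y : K} {z₁ z₂ : L}
    (h₁ : SamePosition G y z₁) (h₂ : SamePosition G y z₂) {c : L}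
    (hc₁ : min z₁ z₂ ≤ c) (hc₂ : c ≤ max z₁ z₂) : SamePosition G y c :=
  (h₁.comm.of_between h₂.comm hc₁ hc₂).of_comm

/-- A point that is not matched has a neighbourhood of points with the same position. -/
theorem SamePosition.exists_interval [DenselyOrdered K] [NoMinOrder K] [NoMaxOrder K]
    {G : PartialIso K L} {y : K} {z : L} (h : SamePosition G y z) (hy : ∀ g ∈ G.1, g.1 ≠ y) :
    ∃ u v, u < y ∧ y < v ∧ SamePosition G u z ∧ SamePosition G v z := by
  have : Nonempty K := ⟨y⟩
  obtain ⟨u, hu₁, hu₂⟩ := exists_between_finsets ((G.1.image Prod.fst).filter (· < y)) {y}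
    (by simp)
  obtain ⟨v, hv₁, hv₂⟩ := exists_between_finsets {y} ((G.1.image Prod.fst).filter (y < ·))
    (by simp)
  simp only [Finset.mem_filter, Finset.mem_image, Finset.mem_singleton] at hu₁ hu₂ hv₁ hv₂
  have hu := hu₂ y rfl
  have hv := hv₁ y rfl
  refine ⟨u, v, hu, hv, .mk (fun g hg => ?_) (fun g hg => ?_),
    .mk (fun g hg => ?_) (fun g hg => ?_)⟩
  · rw [← h.lt_iff hg]
    exact ⟨fun h => h.trans hu, fun h => hu₁ g.1 ⟨⟨g, hg, rfl⟩, h⟩⟩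
  · rw [← h.gt_iff hg]
    refine ⟨fun h => ?_, fun h => hu.trans h⟩
    rcases lt_or_gt_of_ne (hy g hg) with h' | h'
    · exact absurd h (hu₁ g.1 ⟨⟨g, hg, rfl⟩, h'⟩).not_gt
    · exact h'
  · rw [← h.lt_iff hg]
    refine ⟨fun h => ?_, fun h => h.trans hv⟩
    rcases lt_or_gt_of_ne (hy g hg) with h' | h'
    · exact h'
    · exact absurd h (hv₂ g.1 ⟨⟨g, hg, rfl⟩, h'⟩).not_gt
  · rw [← h.gt_iff hg]
    exact ⟨fun h => hv.trans h, fun h => hv₂ g.1 ⟨⟨g, hg, rfl⟩, h⟩⟩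

end SamePosition

/-! ### Signs of two polynomials on the cells cut out by matched points. -/

section Fields

variable {K L : Type*} [Field K] [LinearOrder K] [IsStrictOrderedRing K]
  [Field L] [LinearOrder L] [IsStrictOrderedRing L]

open SignType

theorem PolyIVT.sign_eval_sub [PolyIVT K] (p : K[X]) {a b : K} {s : SignType}
    (h : ∀ c, min a b ≤ c → c ≤ max a b → sign ((derivative p).eval c) = s) :
    sign (p.eval b - p.eval a) = s * sign (b - a) := by
  rcases lt_trichotomy a b with hab | rfl | hab
  · obtain ⟨c, h1, h2, h3⟩ := exists_eval_sub_eq p hab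
    rw [h3, sign_mul, h c ((min_le_left _ _).trans h1.le) (h2.le.trans (le_max_right _ _))]
  · simp
  · obtain ⟨c, h1, h2, h3⟩ := exists_eval_sub_eq p hab
    have h3 : p.eval b - p.eval a = (derivative p).eval c * (b - a) := by linear_combination -h3
    rw [h3, sign_mul, h c ((min_le_right _ _).trans h1.le) (h2.le.trans (le_max_left _ _))]

theorem cmp_neg_neg (a b : K) : cmp (-a) (-b) = cmp b a := by
  simp [cmp, cmpUsing]

/-- The partial isomorphism obtained by reflecting both sides at the origin. -/
def negPartialIso (G : PartialIso K L) : PartialIso K L :=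
  ⟨G.1.image (fun g => (-g.1, -g.2)), by
    intro g hg g' hg'
    obtain ⟨f, hf, rfl⟩ := Finset.mem_image.1 hg
    obtain ⟨f', hf', rfl⟩ := Finset.mem_image.1 hg'
    rw [cmp_neg_neg, cmp_neg_neg, G.2 f' hf' f hf]⟩

theorem samePosition_neg_iff {G : PartialIso K L} {y : K} {z : L} :
    SamePosition (negPartialIso G) y z ↔ SamePosition G (-y) (-z) := by
  constructor
  · intro h
    refine .mk (fun g hg => ?_) (fun g hg => ?_)
    · have := h.gt_iff (Finset.mem_image_of_mem _ hg)
      rwa [lt_neg, lt_neg (a := z)] at this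
    · have := h.lt_iff (Finset.mem_image_of_mem _ hg)
      rwa [neg_lt, neg_lt (b := z)] at this
  · intro h
    refine .mk (fun g hg => ?_) (fun g hg => ?_)
    · obtain ⟨g, hg₀, rfl⟩ := Finset.mem_image.1 hg
      have := h.gt_iff hg₀
      rwa [neg_lt, neg_lt (a := z)] at this
    · obtain ⟨g, hg₀, rfl⟩ := Finset.mem_image.1 hg
      have := h.lt_iff hg₀
      rwa [lt_neg, lt_neg (b := z)] at this

theorem SamePosition.exists_root_between {K : Type*} [LinearOrder K] [PolyIVT L]
    {G : PartialIso K L} {q : L[X]} {y : K} {z₁ z₂ : L} (h₁ : SamePosition G y z₁)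
    (h₂ : SamePosition G y z₂) (hq : q.eval z₁ * q.eval z₂ < 0) :
    ∃ z, SamePosition G y z ∧ q.eval z = 0 := by
  rcases lt_trichotomy z₁ z₂ with hlt | rfl | hlt
  · obtain ⟨c, h3, h4, h5⟩ := PolyIVT.exists_root_of_mul_neg q hlt hq
    exact ⟨c, h₁.of_between_right h₂ ((min_le_left _ _).trans h3.le)
      (h4.le.trans (le_max_right _ _)), h5⟩
  · exact absurd hq (mul_self_nonneg _).not_gt
  · obtain ⟨c, h3, h4, h5⟩ := PolyIVT.exists_root_of_mul_neg q hlt (by rwa [mul_comm])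
    exact ⟨c, h₁.of_between_right h₂ ((min_le_right _ _).trans h3.le)
      (h4.le.trans (le_max_left _ _)), h5⟩

/-- Two polynomials have the same signs at matched points, and their derivatives have the same
signs at points with the same position. -/
structure Compatible {K L : Type*} [Field K] [LinearOrder K] [Field L] [LinearOrder L]
    (G : PartialIso K L) (p : K[X]) (q : L[X]) : Prop where
  sign_eq : ∀ g ∈ G.1, sign (p.eval g.1) = sign (q.eval g.2)
  sign_derivative_eq : ∀ y z, SamePosition G y z →
    sign ((derivative p).eval y) = sign ((derivative q).eval z)

namespace Compatible

variable {G : PartialIso K L} {p : K[X]} {q : L[X]}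

theorem comm {K L : Type*} [Field K] [LinearOrder K] [Field L] [LinearOrder L]
    {G : PartialIso K L} {p : K[X]} {q : L[X]} (h : Compatible G p q) :
    Compatible G.comm q p where
  sign_eq _ hg := (h.sign_eq _ (mem_comm_iff.1 hg)).symm
  sign_derivative_eq y z hyz := (h.sign_derivative_eq z y hyz.of_comm).symm

theorem neg (h : Compatible G p q) : Compatible G (-p) (-q) where
  sign_eq g hg := by simp [Left.sign_neg, h.sign_eq g hg]
  sign_derivative_eq y z hyz := by simp [Left.sign_neg, h.sign_derivative_eq y z hyz]

theorem reflect (h : Compatible G p q) :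
    Compatible (negPartialIso G) (p.comp (-X)) (q.comp (-X)) where
  sign_eq g hg := by
    obtain ⟨f, hf, rfl⟩ := Finset.mem_image.1 hg
    simp [h.sign_eq f hf]
  sign_derivative_eq y z hyz := by
    simp [derivative_comp, Left.sign_neg,
      h.sign_derivative_eq _ _ (samePosition_neg_iff.1 hyz)]

variable [PolyIVT K] [PolyIVT L]

/-- In the cell of `y` both polynomials increase. If the cell is unbounded above, `q` is positive
far out. Otherwise `p` is positive at the right end of the cell, hence so is `q` at the matched end,
and positivity of `q` spreads into the cell. -/
theorem exists_pos_of_derivative_pos (h : Compatible G p q) {y : K} {z : L}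
    (hyz : SamePosition G y z) (hy : ∀ g ∈ G.1, g.1 ≠ y) (hp : 0 < p.eval y)
    (hp' : 0 < (derivative p).eval y) : ∃ z', SamePosition G y z' ∧ 0 < q.eval z' := by
  by_cases hqz : 0 < q.eval z
  · exact ⟨z, hyz, hqz⟩
  have hsign := sign_pos hp'
  rcases (G.1.filter (fun g => y < g.1)).eq_empty_or_nonempty with hS | hS
  · have key : ∀ w, z < w → SamePosition G y w := by
      intro w hw
      have hlt : ∀ g ∈ G.1, g.1 < y := fun g hg => by
        rcases lt_or_gt_of_ne (hy g hg) with h' | h'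
        · exact h'
        · exact absurd (hS ▸ Finset.mem_filter.2 ⟨hg, h'⟩) (Finset.notMem_empty g)
      refine .mk (fun g hg => ?_) (fun g hg => ?_)
      · exact iff_of_true (hlt g hg) (((hyz.lt_iff hg).1 (hlt g hg)).trans hw)
      · exact iff_of_false (hlt g hg).not_gt (((hyz.lt_iff hg).1 (hlt g hg)).trans hw).not_gt
    obtain ⟨w, hw, hqw⟩ := exists_gt_eval_pos (p := q) z (fun w hw => by
      rw [← sign_eq_one_iff, ← h.sign_derivative_eq _ _ (key w hw), hsign])
    exact ⟨w, key w hw, hqw⟩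
  · obtain ⟨g, hg, hmin⟩ := Finset.exists_min_image _ Prod.fst hS
    rw [Finset.mem_filter] at hg
    have hpg : 0 < p.eval g.1 := by
      obtain ⟨c, h1, h2, h3⟩ := PolyIVT.exists_eval_sub_eq p hg.2
      have hcz : SamePosition G c z := by
        refine .mk (fun g' hg' => ?_) (fun g' hg' => ?_)
        · rw [← hyz.lt_iff hg']
          refine ⟨fun h' => ?_, fun h' => h'.trans h1⟩
          by_contra h''
          have := hmin g' (Finset.mem_filter.2 ⟨hg', lt_of_le_of_ne (not_lt.1 h'') (hy g' hg').symm⟩)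
          exact (h'.trans h2).not_ge this
        · rw [← hyz.gt_iff hg']
          exact ⟨fun h' => h1.trans h', fun h' =>
            h2.trans_le (hmin g' (Finset.mem_filter.2 ⟨hg', h'⟩))⟩
      have hc : 0 < (derivative p).eval c := by
        rw [← sign_eq_one_iff, h.sign_derivative_eq _ _ hcz, ← h.sign_derivative_eq _ _ hyz, hsign]
      have := mul_pos hc (sub_pos.2 hg.2)
      linarith
    have hqg : 0 < q.eval g.2 := by
      rw [← sign_eq_one_iff, ← h.sign_eq g hg.1, sign_eq_one_iff]
      exact hpg
    -- Here `q` is at most `0` at `z`, so the value `q.eval g.2 / 2` is taken strictly inside the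
    -- cell, where `q` is still positive.
    obtain ⟨w, h1, h2, h3⟩ := PolyIVT.exists_eval_eq q (v := q.eval g.2 / 2)
      ((hyz.gt_iff hg.1).1 hg.2) (mul_neg_of_neg_of_pos (by linarith) (by linarith))
    refine ⟨w, .mk (fun g' hg' => ?_) (fun g' hg' => ?_), by linarith⟩
    · rw [hyz.lt_iff hg']
      refine ⟨fun h' => h'.trans h1, fun h' => ?_⟩
      by_contra h''
      have hlt : z < g'.2 := by
        refine lt_of_le_of_ne (not_lt.1 h'') fun h0 => hy g' hg' ((hyz.eq_iff hg').2 h0.symm)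
      have := hmin g' (Finset.mem_filter.2 ⟨hg', (hyz.gt_iff hg').2 hlt⟩)
      have := mt (lt_iff_lt_of_cmp_eq_cmp (G.2 g' hg' g hg.1)).2 this.not_gt
      exact this (h'.trans h2)
    · rw [hyz.gt_iff hg']
      refine ⟨fun h' => ?_, fun h' => h1.trans h'⟩
      have := hmin g' (Finset.mem_filter.2 ⟨hg', (hyz.gt_iff hg').2 h'⟩)
      have := mt (lt_iff_lt_of_cmp_eq_cmp (G.2 g' hg' g hg.1)).2 this.not_gt
      exact h2.trans_le (not_lt.1 this)

theorem exists_pos (h : Compatible G p q) {y : K} {z : L}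
    (hyz : SamePosition G y z) (hy : ∀ g ∈ G.1, g.1 ≠ y) (hp : 0 < p.eval y)
    (hp' : (derivative p).eval y ≠ 0) : ∃ z', SamePosition G y z' ∧ 0 < q.eval z' := by
  rcases lt_or_gt_of_ne hp' with hp' | hp'
  · obtain ⟨w, h1, h2⟩ := h.reflect.exists_pos_of_derivative_pos (y := -y) (z := -z)
      (samePosition_neg_iff.2 (by simpa using hyz))
      (by
        intro g hg
        obtain ⟨f, hf, rfl⟩ := Finset.mem_image.1 hg
        simpa using hy f hf)
      (by simpa using hp) (by simpa [derivative_comp] using hp')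
    exact ⟨-w, by simpa using samePosition_neg_iff.1 h1, by simpa using h2⟩
  · exact h.exists_pos_of_derivative_pos hyz hy hp hp'

theorem exists_neg (h : Compatible G p q) {y : K} {z : L}
    (hyz : SamePosition G y z) (hy : ∀ g ∈ G.1, g.1 ≠ y) (hp : p.eval y < 0)
    (hp' : (derivative p).eval y ≠ 0) : ∃ z', SamePosition G y z' ∧ q.eval z' < 0 := by
  simpa using h.neg.exists_pos hyz hy (by simpa using hp) (by simpa using hp')

/-- Nonzero signs are handled by `exists_pos` and `exists_neg`. If `p` vanishes at `y`, it is
strictly monotone on the cell and takes both signs near `y`; hence `q` takes both signs on the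
matching cell and vanishes somewhere in it. -/
theorem exists_sign_eq (h : Compatible G p q) {y : K} {z : L}
    (hyz : SamePosition G y z) (hy : ∀ g ∈ G.1, g.1 ≠ y)
    (hp' : (derivative p).eval y ≠ 0) :
    ∃ z', SamePosition G y z' ∧ sign (p.eval y) = sign (q.eval z') := by
  rcases lt_trichotomy (p.eval y) 0 with hp | hp | hp
  · obtain ⟨z', h1, h2⟩ := h.exists_neg hyz hy hp hp'
    exact ⟨z', h1, by rw [sign_neg hp, sign_neg h2]⟩
  · obtain ⟨u, v, hu, hv, huz, hvz⟩ := hyz.exists_interval hy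
    have hcell : ∀ {w}, SamePosition G w z → 
        sign ((derivative p).eval w) = sign ((derivative p).eval y) := fun {w} hw => by
      rw [h.sign_derivative_eq _ _ hw, h.sign_derivative_eq _ _ hyz]
    have hne : ∀ {w}, SamePosition G w z → (derivative p).eval w ≠ 0 := fun {w} hw h0 => by
      have := hcell hw
      rw [h0, sign_zero, eq_comm, sign_eq_zero_iff] at this
      exact hp' this
    have hsign : ∀ {w}, SamePosition G w z →
        sign (p.eval w) = sign ((derivative p).eval y) * sign (w - y) := fun {w} hw => by
      have := PolyIVT.sign_eval_sub p (a := y) (b := w)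
        (fun c h1 h2 => hcell (hyz.of_between hw h1 h2))
      rwa [hp, sub_zero] at this
    have hmem : ∀ {w}, SamePosition G w z → ∀ g ∈ G.1, g.1 ≠ w := fun {w} hw g hg h0 =>
      hy g hg ((hyz.eq_iff hg).2 ((hw.eq_iff hg).1 h0))
    have hsu := hsign huz
    have hsv := hsign hvz
    rw [sign_neg (sub_neg.2 hu)] at hsu
    rw [sign_pos (sub_pos.2 hv), mul_one] at hsv
    have key : ∃ z₁ z₂, SamePosition G y z₁ ∧ SamePosition G y z₂ ∧
        q.eval z₁ * q.eval z₂ < 0 := by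
      rcases lt_or_gt_of_ne hp' with hp' | hp'
      · rw [sign_neg hp'] at hsu hsv
        have hu0 : 0 < p.eval u := sign_eq_one_iff.1 hsu
        have hv0 : p.eval v < 0 := sign_eq_neg_one_iff.1 hsv
        obtain ⟨z₁, h1, h2⟩ := h.exists_pos huz (hmem huz) hu0 (hne huz)
        obtain ⟨z₂, h3, h4⟩ := h.exists_neg hvz (hmem hvz) hv0 (hne hvz)
        exact ⟨z₁, z₂, h1.congr huz hyz, h3.congr hvz hyz, mul_neg_of_pos_of_neg h2 h4⟩
      · rw [sign_pos hp'] at hsu hsv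
        have hu0 : p.eval u < 0 := sign_eq_neg_one_iff.1 hsu
        have hv0 : 0 < p.eval v := sign_eq_one_iff.1 hsv
        obtain ⟨z₁, h1, h2⟩ := h.exists_neg huz (hmem huz) hu0 (hne huz)
        obtain ⟨z₂, h3, h4⟩ := h.exists_pos hvz (hmem hvz) hv0 (hne hvz)
        exact ⟨z₁, z₂, h1.congr huz hyz, h3.congr hvz hyz, mul_neg_of_neg_of_pos h2 h4⟩
    obtain ⟨z₁, z₂, h1, h2, h3⟩ := key
    obtain ⟨z', h4, h5⟩ := h1.exists_root_between h2 h3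
    exact ⟨z', h4, by rw [hp, h5, sign_zero, sign_zero]⟩
  · obtain ⟨z', h1, h2⟩ := h.exists_pos hyz hy hp hp'
    exact ⟨z', h1, by rw [sign_pos hp, sign_pos h2]⟩

end Compatible

end Fields
end

/-! ## Sign tables -/

noncomputable section

open Polynomial Order SignType

section Fields

variable {K L : Type*} [Field K] [LinearOrder K] [IsStrictOrderedRing K] [PolyIVT K]
  [Field L] [LinearOrder L] [IsStrictOrderedRing L] [PolyIVT L]

open scoped Classical in
/-- Add to a partial isomorphism the pairs of roots of two polynomials that have the same
position. -/
theorem Compatible.exists_extension {G : PartialIso K L} {p : K[X]} {q : L[X]}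
    (h : Compatible G p q) (hp : p ≠ 0) (hq : q ≠ 0)
    (hpG : ∀ y, (derivative p).eval y = 0 → ∃ g ∈ G.1, g.1 = y)
    (hqG : ∀ z, (derivative q).eval z = 0 → ∃ g ∈ G.1, g.2 = z) :
    ∃ G' : PartialIso K L, G.1 ⊆ G'.1 ∧
      (∀ g ∈ G'.1, g ∈ G.1 ∨ (p.eval g.1 = 0 ∧ q.eval g.2 = 0)) ∧
      ∀ y z, SamePosition G' y z → sign (p.eval y) = sign (q.eval z) := by
  let N : Finset (K × L) := (p.roots.toFinset ×ˢ q.roots.toFinset).filter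
    fun g => SamePosition G g.1 g.2
  have hN : ∀ g, g ∈ N ↔ p.eval g.1 = 0 ∧ q.eval g.2 = 0 ∧ SamePosition G g.1 g.2 := by
    intro g
    simp [N, hp, hq, and_assoc]
  -- By Rolle a root of the derivative separates two roots of `p`. It is matched in `G`, so its
  -- partner separates the corresponding roots of `q`.
  have hltK : ∀ g ∈ N, ∀ g' ∈ N, g.1 < g'.1 → g.2 < g'.2 := by
    intro g hg g' hg' hlt
    obtain ⟨h1, h2, h3⟩ := (hN g).1 hg
    obtain ⟨h1', h2', h3'⟩ := (hN g').1 hg'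
    obtain ⟨c, hc1, hc2, hc3⟩ := PolyIVT.exists_derivative_eq_zero p hlt h1 h1'
    obtain ⟨f, hf, rfl⟩ := hpG c hc3
    exact ((h3.gt_iff hf).1 hc1).trans ((h3'.lt_iff hf).1 hc2)
  have hltL : ∀ g ∈ N, ∀ g' ∈ N, g.2 < g'.2 → g.1 < g'.1 := by
    intro g hg g' hg' hlt
    obtain ⟨h1, h2, h3⟩ := (hN g).1 hg
    obtain ⟨h1', h2', h3'⟩ := (hN g').1 hg'
    obtain ⟨c, hc1, hc2, hc3⟩ := PolyIVT.exists_derivative_eq_zero q hlt h2 h2'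
    obtain ⟨f, hf, rfl⟩ := hqG c hc3
    exact ((h3.gt_iff hf).2 hc1).trans ((h3'.lt_iff hf).2 hc2)
  let G' : PartialIso K L := ⟨G.1 ∪ N, by
    intro g hg g' hg'
    rcases Finset.mem_union.1 hg with hg | hg <;> rcases Finset.mem_union.1 hg' with hg' | hg'
    · exact G.2 g hg g' hg'
    · exact ((hN g').1 hg').2.2 g hg
    · rw [← cmp_swap, ((hN g).1 hg).2.2 g' hg', cmp_swap]
    · rcases lt_trichotomy g.1 g'.1 with h' | h' | h'
      · rw [(cmp_eq_lt_iff _ _).2 h', (cmp_eq_lt_iff _ _).2 (hltK g hg g' hg' h')]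
      · have : g.2 = g'.2 := le_antisymm
          (not_lt.1 fun h0 => (hltL g' hg' g hg h0).ne h'.symm)
          (not_lt.1 fun h0 => (hltL g hg g' hg' h0).ne h')
        rw [(cmp_eq_eq_iff _ _).2 h', (cmp_eq_eq_iff _ _).2 this]
      · rw [(cmp_eq_gt_iff _ _).2 h', (cmp_eq_gt_iff _ _).2 (hltK g' hg' g hg h')]⟩
  refine ⟨G', Finset.subset_union_left, fun g hg => ?_, fun y z hyz' => ?_⟩
  · exact (Finset.mem_union.1 hg).imp id fun hg => ⟨((hN g).1 hg).1, ((hN g).1 hg).2.1⟩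
  have hyz : SamePosition G y z := fun g hg => hyz' g (Finset.mem_union_left _ hg)
  by_cases hy : ∃ g ∈ G.1, g.1 = y
  · obtain ⟨g, hg, rfl⟩ := hy
    rw [h.sign_eq g hg, (hyz.eq_iff hg).1 rfl]
  have hy' : ∀ g ∈ G.1, g.1 ≠ y := fun g hg h0 => hy ⟨g, hg, h0⟩
  have hz' : ∀ g ∈ G.comm.1, g.1 ≠ z := fun g hg h0 =>
    hy' _ (mem_comm_iff.1 hg) ((hyz.eq_iff (mem_comm_iff.1 hg)).2 h0)
  have hdy : (derivative p).eval y ≠ 0 := fun h0 => hy (hpG y h0)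
  have hdz : (derivative q).eval z ≠ 0 := fun h0 => by
    obtain ⟨g, hg, h1⟩ := hqG z h0
    exact hy' g hg ((hyz.eq_iff hg).2 h1)
  obtain ⟨z', hz'y, hsz'⟩ := h.exists_sign_eq hyz hy' hdy
  -- A root on either side belongs to a new matched pair, and the common position with respect to
  -- that pair makes the other point a root too.
  by_cases hpy : p.eval y = 0
  · rw [hpy, sign_zero, eq_comm, sign_eq_zero_iff] at hsz'
    have hmem : (y, z') ∈ G'.1 := Finset.mem_union_right _ ((hN _).2 ⟨hpy, hsz', hz'y⟩)
    rw [← (hyz'.eq_iff hmem).1 rfl, hpy, hsz', sign_zero, sign_zero]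
  have hqz : q.eval z ≠ 0 := by
    intro hqz
    obtain ⟨y', hy'z, hsy'⟩ := h.comm.exists_sign_eq hyz.comm hz' hdz
    rw [hqz, sign_zero, eq_comm, sign_eq_zero_iff] at hsy'
    have hmem : (y', z) ∈ G'.1 :=
      Finset.mem_union_right _ ((hN _).2 ⟨hsy', hqz, hy'z.of_comm⟩)
    exact hpy (by rw [← (hyz'.eq_iff hmem).2 rfl]; exact hsy')
  by_contra hne
  have hqz' : q.eval z' ≠ 0 := by
    rw [← sign_ne_zero, ← hsz', sign_ne_zero]
    exact hpy
  have hmul : q.eval z * q.eval z' < 0 := by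
    by_contra h0
    have h1 := lt_of_le_of_ne (not_lt.1 h0) (mul_ne_zero hqz hqz').symm
    apply hne
    rw [hsz']
    rcases pos_and_pos_or_neg_and_neg_of_mul_pos h1 with ⟨h2, h3⟩ | ⟨h2, h3⟩
    · rw [sign_pos h2, sign_pos h3]
    · rw [sign_neg h2, sign_neg h3]
  -- Opposite nonzero signs would force a root `z₀` of `q` in the cell, matched with a root `y₀` of
  -- `p`. Monotonicity then reads both signs off the positions of `y` and `z` relative to `(y₀,
  -- z₀)`, and these agree.
  obtain ⟨z₀, hyz₀, hz₀⟩ := hyz.exists_root_between hz'y hmul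
  have hz₀' : ∀ g ∈ G.comm.1, g.1 ≠ z₀ := fun g hg h0 =>
    hy' _ (mem_comm_iff.1 hg) ((hyz₀.eq_iff (mem_comm_iff.1 hg)).2 h0)
  have hdz₀ : (derivative q).eval z₀ ≠ 0 := fun h0 => by
    obtain ⟨g, hg, h1⟩ := hqG z₀ h0
    exact hy' g hg ((hyz₀.eq_iff hg).2 h1)
  obtain ⟨y₀, hy₀, hsy₀⟩ := h.comm.exists_sign_eq hyz₀.comm hz₀' hdz₀
  rw [hz₀, sign_zero, eq_comm, sign_eq_zero_iff] at hsy₀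
  have hy₀ := hy₀.of_comm
  have hmem : (y₀, z₀) ∈ G'.1 := Finset.mem_union_right _ ((hN _).2 ⟨hsy₀, hz₀, hy₀⟩)
  have hy₀z : SamePosition G y₀ z := hyz.congr hyz₀ hy₀
  have e1 := PolyIVT.sign_eval_sub p (a := y₀) (b := y) (fun c h1 h2 =>
    h.sign_derivative_eq c z (hy₀z.of_between hyz h1 h2))
  have e2 := PolyIVT.sign_eval_sub q (a := z₀) (b := z) (fun c h1 h2 =>
    (h.sign_derivative_eq y c (hyz₀.of_between_right hyz h1 h2)).symm)
  rw [hsy₀, sub_zero] at e1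
  rw [hz₀, sub_zero] at e2
  rw [h.sign_derivative_eq y z hyz] at e2
  apply hne
  rw [e1, e2]
  congr 1
  rcases lt_trichotomy y₀ y with h' | h' | h'
  · rw [sign_pos (sub_pos.2 h'), sign_pos (sub_pos.2 ((hyz'.lt_iff hmem).1 h'))]
  · have h'' : z₀ = z := (hyz'.eq_iff hmem).1 h'
    rw [h', h'', sub_self, sub_self, sign_zero, sign_zero]
  · rw [sign_neg (sub_neg.2 h'), sign_neg (sub_neg.2 ((hyz'.gt_iff hmem).1 h'))]

end Fields

/-! ### Cohen–Hörmander sign tables and transfer in one variable. -/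

section Table

variable {F K L : Type*} [Field F] [Field K] [LinearOrder K] [Field L] [LinearOrder L]

/-- A sign table for a set of polynomials over a common subfield: matched points are common roots
of a member of the set, and the members of the set have the same signs at points with the same
position. -/
structure IsSignTable (α : F →+* K) (β : F →+* L) (P : Finset F[X]) (G : PartialIso K L) :
    Prop where
  exists_root : ∀ g ∈ G.1, ∃ q ∈ P, q ≠ 0 ∧ q.eval₂ α g.1 = 0 ∧ q.eval₂ β g.2 = 0
  sign_eq : ∀ p ∈ P, ∀ y z, SamePosition G y z → sign (p.eval₂ α y) = sign (p.eval₂ β z)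

theorem IsSignTable.comm {α : F →+* K} {β : F →+* L} {P : Finset F[X]}
    {G : PartialIso K L} (h : IsSignTable α β P G) : IsSignTable β α P G.comm where
  exists_root g hg := by
    obtain ⟨q, h1, h2, h3, h4⟩ := h.exists_root _ (mem_comm_iff.1 hg)
    exact ⟨q, h1, h2, h4, h3⟩
  sign_eq p hp y z hyz := (h.sign_eq p hp z y hyz.of_comm).symm

variable [IsStrictOrderedRing K] [IsStrictOrderedRing L]

/-- The roots of the members of a sign table are matched. -/
theorem IsSignTable.exists_mem_of_root {α : F →+* K} {β : F →+* L} {P : Finset F[X]}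
    {G : PartialIso K L} (h : IsSignTable α β P G) {p : F[X]} (hp : p ∈ P) (hp0 : p ≠ 0) {y : K}
    (hy : p.eval₂ α y = 0) : ∃ g ∈ G.1, g.1 = y := by
  by_contra hcon
  obtain ⟨z, hz⟩ := G.exists_across y
  have hz : SamePosition G y z := hz
  obtain ⟨u, v, hu, hv, hu', hv'⟩ := hz.exists_interval (fun g hg h0 => hcon ⟨g, hg, h0⟩)
  have hpz := h.sign_eq p hp y z hz
  rw [hy, sign_zero, eq_comm, sign_eq_zero_iff] at hpz
  -- Every point near an unmatched root has the position of `z`, where the polynomial vanishes over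
  -- `L`; so it vanishes on a whole interval.
  have hzero : ∀ c ∈ Set.Ioo u v, (p.map α).eval c = 0 := by
    intro c hc
    have := h.sign_eq p hp c z (hu'.of_between hv' ((min_le_left _ _).trans hc.1.le)
      (hc.2.le.trans (le_max_right _ _)))
    rw [hpz, sign_zero, sign_eq_zero_iff] at this
    rw [eval_map, this]
  have := Polynomial.eq_zero_of_infinite_isRoot (p.map α)
    ((Set.Ioo_infinite (hu.trans hv)).mono hzero)
  exact hp0 ((Polynomial.map_eq_zero α).1 this)

variable [PolyIVT K] [PolyIVT L]

-- The old table determines the sign of `p` at matched points through the remainders and its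
-- monotonicity on cells through the derivative, so `Compatible.exists_extension` applies.
open scoped Classical in
theorem IsSignTable.exists_insert {α : F →+* K} {β : F →+* L} {P : Finset F[X]}
    {G : PartialIso K L} (h : IsSignTable α β P G) {p : F[X]} (hdeg : p.natDegree ≠ 0)
    (hder : derivative p ∈ P) (hmod : ∀ q ∈ P, q.natDegree ≠ 0 → p % q ∈ P) :
    ∃ G', IsSignTable α β (insert p P) G' := by
  have : CharZero F := α.charZero
  have hp0 : p ≠ 0 := by rintro rfl; simp at hdeg
  have hd0 : derivative p ≠ 0 := derivative_ne_zero.2 hdeg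
  have hdα : ∀ y, (derivative (p.map α)).eval y = (derivative p).eval₂ α y := fun y => by
    rw [derivative_map, eval_map]
  have hdβ : ∀ y, (derivative (p.map β)).eval y = (derivative p).eval₂ β y := fun y => by
    rw [derivative_map, eval_map]
  have hcomp : Compatible G (p.map α) (p.map β) := by
    constructor
    · intro g hg
      obtain ⟨q, hq, hq0, h1, h2⟩ := h.exists_root g hg
      have hqd : q.natDegree ≠ 0 := by
        intro h0
        rw [eq_C_of_natDegree_eq_zero h0] at h1 hq0
        simp at h1
        simp [h1] at hq0
      -- At a common root of `q`, the value of `p` is that of `p % q`.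
      have hs := h.sign_eq _ (hmod q hq hqd) g.1 g.2 (fun g' hg' => G.2 g' hg' g hg)
      rw [eval_map, eval_map]
      conv_lhs => rw [← EuclideanDomain.div_add_mod p q]
      conv_rhs => rw [← EuclideanDomain.div_add_mod p q]
      simp only [eval₂_add, eval₂_mul, h1, h2, zero_mul, zero_add]
      exact hs
    · intro y z hyz
      rw [hdα, hdβ]
      exact h.sign_eq _ hder y z hyz
  obtain ⟨G', hsub, hroot, hsign⟩ := hcomp.exists_extension
    ((Polynomial.map_ne_zero_iff α.injective).2 hp0)
    ((Polynomial.map_ne_zero_iff β.injective).2 hp0)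
    (fun y hy => h.exists_mem_of_root hder hd0 (by rwa [hdα] at hy))
    (fun z hz => by
      obtain ⟨g, hg, h1⟩ := h.comm.exists_mem_of_root hder hd0 (by rwa [hdβ] at hz)
      exact ⟨_, mem_comm_iff.1 hg, h1⟩)
  refine ⟨G', fun g hg => ?_, fun q hq y z hyz => ?_⟩
  · rcases hroot g hg with hg | hg
    · obtain ⟨q, hq, h'⟩ := h.exists_root g hg
      exact ⟨q, Finset.mem_insert_of_mem hq, h'⟩
    · rw [eval_map, eval_map] at hg
      exact ⟨p, Finset.mem_insert_self _ _, hp0, hg⟩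
  · rcases Finset.mem_insert.1 hq with rfl | hq
    · simpa only [eval_map] using hsign y z hyz
    · exact h.sign_eq q hq y z (fun g hg => hyz g (hsub hg))

/-- A set of polynomials closed under derivatives and remainders. -/
structure IsClosedUnderDerivMod (S : Finset F[X]) : Prop where
  derivative_mem : ∀ p ∈ S, p.natDegree ≠ 0 → derivative p ∈ S
  mod_mem : ∀ p ∈ S, ∀ q ∈ S, q.natDegree ≠ 0 → p % q ∈ S

theorem Polynomial.mod_eq_self_of_natDegree_lt {p q : F[X]} (h : p.natDegree < q.natDegree) :
    p % q = p := by
  rw [Polynomial.mod_eq_self_iff (by rintro rfl; simp at h)]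
  exact degree_lt_degree h

/-- Polynomials are inserted by increasing degree. Derivatives and remainders have smaller degree
than the one inserted last, so they are already in the table. -/
theorem exists_isSignTable {α : F →+* K} {β : F →+* L}
    (hαβ : ∀ a, sign (α a) = sign (β a)) (S : Finset F[X]) (hS : IsClosedUnderDerivMod S) :
    ∃ G, IsSignTable α β S G := by
  classical
  induction S using Finset.induction_on_max_value (fun p : F[X] => p.natDegree) with
  | empty => exact ⟨default, fun g hg => absurd hg (Finset.notMem_empty g), by simp⟩
  | insert p s hps hmax ih =>
    have hlt : ∀ q ∈ insert p s, q.natDegree ≤ p.natDegree := by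
      intro q hq
      rcases Finset.mem_insert.1 hq with rfl | hq
      exacts [le_rfl, hmax q hq]
    have hder : ∀ q ∈ insert p s, q.natDegree ≠ 0 → derivative q ∈ s := fun q hq h0 =>
      (Finset.mem_insert.1 (hS.derivative_mem q hq h0)).resolve_left fun h => by
        have := natDegree_derivative_lt h0
        have := hlt q hq
        rw [h] at *
        omega
    have hmod : ∀ q ∈ insert p s, ∀ r ∈ insert p s, r.natDegree ≠ 0 → q % r ∈ s :=
      fun q hq r hr h0 =>
      (Finset.mem_insert.1 (hS.mod_mem q hq r hr h0)).resolve_left fun h => by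
        have := natDegree_mod_lt q h0
        have := hlt r hr
        rw [h] at *
        omega
    obtain ⟨G, hG⟩ := ih ⟨fun q hq => hder q (Finset.mem_insert_of_mem hq),
      fun q hq r hr => hmod q (Finset.mem_insert_of_mem hq) r (Finset.mem_insert_of_mem hr)⟩
    by_cases h0 : p.natDegree = 0
    · refine ⟨G, fun g hg => ?_, fun q hq y z hyz => ?_⟩
      · obtain ⟨q, hq, h'⟩ := hG.exists_root g hg
        exact ⟨q, Finset.mem_insert_of_mem hq, h'⟩
      · rcases Finset.mem_insert.1 hq with rfl | hq
        · rw [eq_C_of_natDegree_eq_zero h0, eval₂_C, eval₂_C]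
          exact hαβ _
        · exact hG.sign_eq q hq y z hyz
    · exact hG.exists_insert h0 (hder p (Finset.mem_insert_self _ _) h0)
        (fun q hq => hmod p (Finset.mem_insert_self _ _) q (Finset.mem_insert_of_mem hq))

/-- Both operations lower the degree, so a finite set can be saturated from the top degree down.
After `k` rounds it is closed for the derivatives of, and the divisions by, its members of degree
above `D - k`. -/
theorem exists_isClosedUnderDerivMod (P : Finset F[X]) :
    ∃ S, P ⊆ S ∧ IsClosedUnderDerivMod S := by
  classical
  set D := P.sup natDegree
  have key : ∀ k, ∃ S : Finset F[X], P ⊆ S ∧ (∀ p ∈ S, p.natDegree ≤ D) ∧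
      (∀ p ∈ S, D < p.natDegree + k → p.natDegree ≠ 0 → derivative p ∈ S) ∧
      ∀ p ∈ S, ∀ q ∈ S, D < q.natDegree + k → q.natDegree ≠ 0 → p % q ∈ S := by
    intro k
    induction k with
    | zero =>
      refine ⟨P, subset_rfl, fun p hp => Finset.le_sup hp, fun p hp h => ?_, fun p _ q hq h => ?_⟩
      · exact absurd (Finset.le_sup (f := natDegree) hp) (by simpa using h)
      · exact absurd (Finset.le_sup (f := natDegree) hq) (by simpa using h)
    | succ k ih =>
      obtain ⟨S, hPS, hD, hder, hmod⟩ := ih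
      let T := S.filter fun p => D ≤ p.natDegree + k ∧ p.natDegree ≠ 0
      let S' := S ∪ T.image derivative ∪ (T ×ˢ T).image fun r => r.1 % r.2
      have hT : ∀ p, p ∈ T ↔ p ∈ S ∧ D ≤ p.natDegree + k ∧ p.natDegree ≠ 0 := by simp [T]
      -- A round creates only polynomials below the degree just treated, so earlier closure is not
      -- disturbed.
      have hS' : ∀ p ∈ S', p ∈ S ∨ p.natDegree + k < D := by
        intro p hp
        simp only [S', Finset.mem_union, Finset.mem_image, Finset.mem_product, Prod.exists] at hp
        rcases hp with (hp | ⟨q, hq, rfl⟩) | ⟨q, r, ⟨hq, hr⟩, rfl⟩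
        · exact Or.inl hp
        · obtain ⟨h1, h2, h3⟩ := (hT q).1 hq
          have := natDegree_derivative_lt h3
          rcases h2.lt_or_eq with h2 | h2
          · exact Or.inl (hder q h1 h2 h3)
          · exact Or.inr (by omega)
        · obtain ⟨h1, h2, h3⟩ := (hT q).1 hq
          obtain ⟨h1', h2', h3'⟩ := (hT r).1 hr
          have := natDegree_mod_lt q h3'
          rcases h2'.lt_or_eq with h2' | h2'
          · exact Or.inl (hmod q h1 r h1' h2' h3')
          · exact Or.inr (by omega)
      have hTS' : ∀ p ∈ S', D < p.natDegree + (k + 1) → p.natDegree ≠ 0 → p ∈ T := by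
        intro p hp h1 h2
        rcases hS' p hp with h | h
        · exact (hT p).2 ⟨h, by omega, h2⟩
        · omega
      refine ⟨S', fun p hp => ?_, fun p hp => ?_, fun p hp h1 h2 => ?_, fun p hp q hq h1 h2 => ?_⟩
      · exact Finset.mem_union_left _ (Finset.mem_union_left _ (hPS hp))
      · rcases hS' p hp with h | h
        · exact hD p h
        · omega
      · exact Finset.mem_union_left _ (Finset.mem_union_right _
          (Finset.mem_image_of_mem _ (hTS' p hp h1 h2)))
      · by_cases hpq : p.natDegree < q.natDegree
        · rwa [mod_eq_self_of_natDegree_lt hpq]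
        · exact Finset.mem_union_right _ (Finset.mem_image.2 ⟨(p, q), Finset.mem_product.2
            ⟨hTS' p hp (by omega) (by omega), hTS' q hq h1 h2⟩, rfl⟩)
  obtain ⟨S, h1, h2, h3, h4⟩ := key (D + 1)
  exact ⟨S, h1, fun p hp => h3 p hp (by omega), fun p hp q hq => h4 p hp q hq (by omega)⟩

/-- Sign conditions on finitely many polynomials over a common subfield that are realized in one
field with the intermediate value property for polynomials are realized in any other. -/
theorem exists_forall_sign_eval₂_eq {α : F →+* K} {β : F →+* L}
    (hαβ : ∀ a, sign (α a) = sign (β a)) (P : Finset F[X]) (y : K) :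
    ∃ z : L, ∀ p ∈ P, sign (p.eval₂ α y) = sign (p.eval₂ β z) := by
  obtain ⟨S, hPS, hS⟩ := exists_isClosedUnderDerivMod P
  obtain ⟨G, hG⟩ := exists_isSignTable hαβ S hS
  obtain ⟨z, hz⟩ := G.exists_across y
  exact ⟨z, fun p hp => hG.sign_eq p (hPS hp) y z hz⟩

end Table
end

/-! ## Sign conditions and real specializations -/

noncomputable section

open Polynomial SignType Filter

/-! ### Transfer for polynomials with coefficients in a ring. -/

section SignTransfer

theorem sign_div_eq_sign_mul {K : Type*} [Field K] [LinearOrder K] [IsStrictOrderedRing K]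
    (u : K) {v : K} (hv : v ≠ 0) : sign (u / v) = sign (u * v) := by
  have h : u * v = u / v * v ^ 2 := by field_simp
  have h0 : 0 < v ^ 2 := lt_of_le_of_ne (sq_nonneg v) (pow_ne_zero 2 hv).symm
  rw [h, sign_mul, sign_pos h0, mul_one]

variable {A K L : Type*} [CommRing A]
  [Field K] [LinearOrder K] [IsStrictOrderedRing K] [PolyIVT K]
  [Field L] [LinearOrder L] [IsStrictOrderedRing L] [PolyIVT L]

theorem exists_forall_sign_eval₂_eq_of_isDomain [IsDomain A] {α : A →+* K} {β : A →+* L}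
    (hα : Function.Injective α) (hβ : Function.Injective β)
    (hαβ : ∀ a, sign (α a) = sign (β a)) (P : Finset A[X]) (y : K) :
    ∃ z : L, ∀ p ∈ P, sign (p.eval₂ α y) = sign (p.eval₂ β z) := by
  classical
  let F := FractionRing A
  let α' : F →+* K := IsFractionRing.lift hα
  let β' : F →+* L := IsFractionRing.lift hβ
  have hα' : ∀ a, α' (algebraMap A F a) = α a := IsFractionRing.lift_algebraMap hα
  have hβ' : ∀ a, β' (algebraMap A F a) = β a := IsFractionRing.lift_algebraMap hβ
  have hsign : ∀ x, sign (α' x) = sign (β' x) := by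
    intro x
    obtain ⟨a, b, hb, rfl⟩ := IsFractionRing.div_surjective (A := A) x
    have hb0 : b ≠ 0 := nonZeroDivisors.ne_zero hb
    rw [map_div₀ α', map_div₀ β', hα', hα', hβ', hβ',
      sign_div_eq_sign_mul _ ((map_ne_zero_iff α hα).2 hb0),
      sign_div_eq_sign_mul _ ((map_ne_zero_iff β hβ).2 hb0),
      ← map_mul, ← map_mul, hαβ]
  obtain ⟨z, hz⟩ := exists_forall_sign_eval₂_eq hsign (P.image (Polynomial.map (algebraMap A F))) y
  refine ⟨z, fun p hp => ?_⟩
  have := hz _ (Finset.mem_image_of_mem _ hp)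
  rw [eval₂_map, eval₂_map] at this
  convert this using 3 <;> ext a
  · exact (hα' a).symm
  · exact (hβ' a).symm

/-- Equal signs make the two kernels equal, so one may pass to the quotient domain. -/
theorem exists_forall_sign_eval₂_eq_of_ring {α : A →+* K} {β : A →+* L}
    (hαβ : ∀ a, sign (α a) = sign (β a)) (P : Finset A[X]) (y : K) :
    ∃ z : L, ∀ p ∈ P, sign (p.eval₂ α y) = sign (p.eval₂ β z) := by
  classical
  have hker : ∀ a, α a = 0 ↔ β a = 0 := fun a => by
    rw [← sign_eq_zero_iff, hαβ, sign_eq_zero_iff]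
  let I := RingHom.ker α
  have : I.IsPrime := RingHom.ker_isPrime α
  let α' : A ⧸ I →+* K := Ideal.Quotient.lift I α fun a ha => ha
  let β' : A ⧸ I →+* L := Ideal.Quotient.lift I β fun a ha => (hker a).1 ha
  have hα' : Function.Injective α' := (injective_iff_map_eq_zero _).2 fun x => by
    obtain ⟨a, rfl⟩ := Ideal.Quotient.mk_surjective x
    intro h
    exact Ideal.Quotient.eq_zero_iff_mem.2 h
  have hβ' : Function.Injective β' := (injective_iff_map_eq_zero _).2 fun x => by
    obtain ⟨a, rfl⟩ := Ideal.Quotient.mk_surjective x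
    intro h
    exact Ideal.Quotient.eq_zero_iff_mem.2 ((hker a).2 h)
  obtain ⟨z, hz⟩ := exists_forall_sign_eval₂_eq_of_isDomain hα' hβ' (fun x => by
    obtain ⟨a, rfl⟩ := Ideal.Quotient.mk_surjective x
    exact hαβ a) (P.image (Polynomial.map (Ideal.Quotient.mk I))) y
  refine ⟨z, fun p hp => ?_⟩
  have := hz _ (Finset.mem_image_of_mem _ hp)
  rwa [eval₂_map, eval₂_map] at this

end SignTransfer

/-! ### Ultraproducts of `ℝ` and descent of coordinates to `ℝ`. -/

section Ultraproduct

/-- Łoś's argument by hand: lift the coefficients to functions on `ι` and choose a root at each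
index where the inequalities hold. -/
instance {ι : Type*} (U : Ultrafilter ι) : PolyIVT (Germ (U : Filter ι) ℝ) where
  exists_root_of_neg_of_pos p a b := by
    obtain ⟨P, rfl⟩ := Polynomial.map_surjective (Germ.coeRingHom (R := ℝ) (U : Filter ι))
      Quotient.mk_surjective p
    have heval : ∀ c : ι → ℝ, (P.map (Germ.coeRingHom (U : Filter ι))).eval (c : Germ _ ℝ) =
        ((fun i => (P.map (Pi.evalRingHom (fun _ => ℝ) i)).eval (c i) : ι → ℝ) : Germ _ ℝ) := by
      intro c
      have h1 := eval₂_at_apply (p := P) (Germ.coeRingHom (R := ℝ) (U : Filter ι)) c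
      rw [← eval_map] at h1
      refine h1.trans ?_
      rw [Germ.coe_coeRingHom]
      congr 1
      funext i
      rw [eval_map]
      exact (eval₂_at_apply (p := P) (Pi.evalRingHom (fun _ => ℝ) i) c).symm
    induction a using Germ.inductionOn with | _ a
    induction b using Germ.inductionOn with | _ b
    intro hab ha hb
    rw [heval] at ha hb
    replace hab := Germ.coe_lt.1 hab
    replace ha := Germ.coe_lt.1 ha
    replace hb := Germ.coe_lt.1 hb
    have key : ∀ i, ∃ c, a i < b i → (P.map (Pi.evalRingHom (fun _ => ℝ) i)).eval (a i) < 0 →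
        0 < (P.map (Pi.evalRingHom (fun _ => ℝ) i)).eval (b i) → a i < c ∧ c < b i ∧
          (P.map (Pi.evalRingHom (fun _ => ℝ) i)).eval c = 0 := by
      intro i
      by_cases h : a i < b i ∧ (P.map (Pi.evalRingHom (fun _ => ℝ) i)).eval (a i) < 0 ∧
        0 < (P.map (Pi.evalRingHom (fun _ => ℝ) i)).eval (b i)
      · obtain ⟨c, hc⟩ := PolyIVT.exists_root_of_neg_of_pos _ h.1 h.2.1 h.2.2
        exact ⟨c, fun _ _ _ => hc⟩
      · exact ⟨0, fun h1 h2 h3 => absurd ⟨h1, h2, h3⟩ h⟩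
    choose c hc using key
    refine ⟨(c : Germ _ ℝ), Germ.coe_lt.2 ?_, Germ.coe_lt.2 ?_, ?_⟩
    · filter_upwards [hab, ha, hb] with i h1 h2 h3 using (hc i h1 h2 h3).1
    · filter_upwards [hab, ha, hb] with i h1 h2 h3 using (hc i h1 h2 h3).2.1
    · rw [heval]
      refine Germ.coe_eq.2 ?_
      filter_upwards [hab, ha, hb] with i h1 h2 h3 using (hc i h1 h2 h3).2.2

theorem Filter.Germ.eventually_sign_eq {ι : Type*} {U : Ultrafilter ι} (f : ι → ℝ) {s : SignType}
    (h : sign (f : Germ (U : Filter ι) ℝ) = s) : ∀ᶠ i in (U : Filter ι), sign (f i) = s := by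
  rcases lt_trichotomy (f : Germ (U : Filter ι) ℝ) 0 with h' | h' | h'
  · rw [sign_neg h'] at h
    filter_upwards [Germ.coe_lt.1 h'] with i hi
    rw [← h]
    exact sign_neg hi
  · rw [h', sign_zero] at h
    filter_upwards [Germ.coe_eq.1 h'] with i hi
    rw [← h, hi]
    exact sign_zero
  · rw [sign_pos h'] at h
    filter_upwards [Germ.coe_lt.1 h'] with i hi
    rw [← h]
    exact sign_pos hi

theorem Filter.Germ.sign_coe_eq {ι : Type*} {U : Ultrafilter ι} (f : ι → ℝ) {s : SignType}
    (h : ∀ᶠ i in (U : Filter ι), sign (f i) = s) : sign (f : Germ (U : Filter ι) ℝ) = s := by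
  obtain ⟨i, h1, h2⟩ := (h.and (eventually_sign_eq f rfl)).exists
  rw [← h1, h2]

/-- A ring homomorphism to an ordered field has real sign approximations if any finite set of
signs of values is attained by a ring homomorphism to `ℝ`. -/
def HasRealSignApproximations {A K : Type*} [CommRing A] [Field K] [LinearOrder K]
    (α : A →+* K) : Prop :=
  ∀ Q : Finset A, ∃ β : A →+* ℝ, ∀ a ∈ Q, sign (β a) = sign (α a)

theorem HasRealSignApproximations.comp {A A' K : Type*} [CommRing A] [CommRing A'] [Field K]
    [LinearOrder K] {α : A →+* K}
    (h : HasRealSignApproximations α) (e : A' →+* A) : HasRealSignApproximations (α.comp e) := by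
  classical
  intro Q
  obtain ⟨β, hβ⟩ := h (Q.image e)
  exact ⟨β.comp e, fun a ha => hβ _ (Finset.mem_image_of_mem _ ha)⟩

/-- A positive real is a square, so every ring morphism from `ℝ` to an ordered field preserves signs
and the identity will do. -/
theorem hasRealSignApproximations_real {K : Type*} [Field K] [LinearOrder K]
    [IsStrictOrderedRing K] (ι : ℝ →+* K) : HasRealSignApproximations ι := by
  refine fun Q => ⟨RingHom.id ℝ, fun a _ => ?_⟩
  have hpos : ∀ r : ℝ, 0 < r → 0 < ι r := fun r hr => by
    rw [← Real.sq_sqrt hr.le, map_pow]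
    exact lt_of_le_of_ne (sq_nonneg _)
      (pow_ne_zero 2 ((map_ne_zero ι).2 (Real.sqrt_pos.2 hr).ne')).symm
  rcases lt_trichotomy a 0 with h | rfl | h
  · have := hpos (-a) (by linarith)
    rw [map_neg, neg_pos] at this
    rw [sign_neg this]
    exact sign_neg h
  · simp
  · rw [sign_pos (hpos a h)]
    exact sign_pos h

variable {A K : Type*} [CommRing A] [Field K] [LinearOrder K] [IsStrictOrderedRing K] [PolyIVT K]

/-- By hypothesis some ultrafilter on the morphisms `A →+* ℝ` contains every set `{β | sign (β a) =
sign (α a)}`. The diagonal morphism to the ultrapower then has exactly the signs of `α` on all of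
`A`. Transfer moves `y` to a germ `z`, and the finitely many conditions hold at some index. -/
theorem HasRealSignApproximations.eval₂ {α : A →+* K} (h : HasRealSignApproximations α) (y : K) :
    HasRealSignApproximations (eval₂RingHom α y) := by
  classical
  intro P
  let S : Set (Set (A →+* ℝ)) := Set.range fun a : A => {β | sign (β a) = sign (α a)}
  obtain ⟨U, hU⟩ := Ultrafilter.exists_ultrafilter_of_finite_inter_nonempty S (by
    intro T hT
    change (T : Set (Set (A →+* ℝ))) ⊆ Set.range _ at hT
    rw [← Set.image_univ] at hT
    obtain ⟨Q, -, hQ⟩ := Finset.subset_set_image_iff.1 hT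
    obtain ⟨β, hβ⟩ := h Q
    refine ⟨β, Set.mem_sInter.2 fun s hs => ?_⟩
    rw [← hQ] at hs
    obtain ⟨a, ha, rfl⟩ := Finset.mem_image.1 hs
    exact hβ a ha)
  let ev : A →+* (A →+* ℝ) → ℝ := RingHom.pi fun β => β
  let β : A →+* Germ (U : Filter (A →+* ℝ)) ℝ := (Germ.coeRingHom _).comp ev
  obtain ⟨z, hz⟩ := exists_forall_sign_eval₂_eq_of_ring (α := α) (β := β) (fun a =>
    (Germ.sign_coe_eq (U := U) (fun β => β a) (hU ⟨a, rfl⟩)).symm) P y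
  induction z using Germ.inductionOn with | _ z
  have heval : ∀ p : A[X], p.eval₂ β (z : Germ (U : Filter (A →+* ℝ)) ℝ) =
      ((fun γ : A →+* ℝ => p.eval₂ γ (z γ) : (A →+* ℝ) → ℝ) : Germ (U : Filter (A →+* ℝ)) ℝ) := by
    intro p
    have h1 := hom_eval₂ p ev (Germ.coeRingHom (U : Filter (A →+* ℝ))) z
    refine h1.symm.trans ?_
    rw [Germ.coe_coeRingHom]
    congr 1
    funext γ
    exact hom_eval₂ p ev (Pi.evalRingHom (fun _ => ℝ) γ) z
  have hev : ∀ᶠ γ in (U : Filter (A →+* ℝ)), ∀ p ∈ P,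
      sign (p.eval₂ γ (z γ)) = sign (p.eval₂ α y) := by
    refine (Filter.eventually_all_finset P).2 fun p hp => ?_
    have := hz p hp
    rw [heval] at this
    exact Germ.eventually_sign_eq _ this.symm
  obtain ⟨γ, hγ⟩ := hev.exists
  exact ⟨eval₂RingHom γ (z γ), hγ⟩

theorem hasRealSignApproximations_mvPolynomial (n : ℕ) (ι : ℝ →+* K) (x : Fin n → K) :
    HasRealSignApproximations (MvPolynomial.eval₂Hom ι x) := by
  induction n with
  | zero =>
    have : MvPolynomial.eval₂Hom ι x =
        ι.comp (MvPolynomial.eval fun i => i.elim0) := by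
      apply MvPolynomial.ringHom_ext
      · intro r
        simp
      · exact fun i => i.elim0
    rw [this]
    exact (hasRealSignApproximations_real ι).comp _
  | succ n ih =>
    have : MvPolynomial.eval₂Hom ι x =
        (eval₂RingHom (MvPolynomial.eval₂Hom ι (fun i => x i.succ)) (x 0)).comp
          (MvPolynomial.finSuccEquiv ℝ n).toRingEquiv.toRingHom := by
      apply MvPolynomial.ringHom_ext
      · intro r
        simp [MvPolynomial.finSuccEquiv_apply]
      · intro i
        refine Fin.cases ?_ (fun i => ?_) i <;> simp [MvPolynomial.finSuccEquiv_apply]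
    rw [this]
    exact ((ih _).eval₂ _).comp _

end Ultraproduct
end

/-! ## Semireal fields -/

noncomputable section

open Polynomial

theorem IsSumSq.map {R S : Type*} [Semiring R] [Semiring S] (f : R →+* S) {s : R}
    (h : IsSumSq s) : IsSumSq (f s) := by
  induction h with
  | zero => rw [map_zero]; exact .zero
  | sq_add a hs ih => rw [map_add, map_mul]; exact .sq_add _ ih

/-! ### Maximal semireal subfields of an algebraically closed field. -/

section Maximal

/-- A field is maximal semireal if every irreducible polynomial whose root field is semireal has
a root. -/
structure IsMaximalSemireal (K : Type*) [Field K] : Prop where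
  not_isSumSq_neg_one : ¬ IsSumSq (-1 : K)
  exists_root : ∀ f : K[X], Irreducible f → ¬ IsSumSq (-1 : AdjoinRoot f) → ∃ x, f.eval x = 0

theorem Subfield.exists_isSumSq_of_sSup {Ω : Type*} [Field Ω] {c : Set (Subfield Ω)}
    (hc : DirectedOn (· ≤ ·) c) (hne : c.Nonempty) {s : (sSup c : Subfield Ω)} (hs : IsSumSq s) :
    ∃ E ∈ c, ∃ t : E, IsSumSq t ∧ (t : Ω) = s := by
  induction hs with
  | zero =>
    obtain ⟨E, hE⟩ := hne
    exact ⟨E, hE, 0, .zero, rfl⟩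
  | @sq_add a s hs ih =>
    obtain ⟨E, hE, t, ht, hts⟩ := ih
    obtain ⟨E', hE', ha⟩ := (Subfield.mem_sSup_of_directedOn hne hc).1 a.2
    obtain ⟨E'', hE'', h1, h2⟩ := hc E hE E' hE'
    refine ⟨E'', hE'', ⟨a, h2 ha⟩ * ⟨a, h2 ha⟩ + Subfield.inclusion h1 t,
      .sq_add _ (ht.map (Subfield.inclusion h1)), ?_⟩
    simp [← hts]
    rfl

/-- Zorn's lemma, since a sum of squares in a directed union lives in one member. The root field of
`f` embeds over `E` in `Ω`; if it is semireal, maximality puts its image, hence a root of `f`, in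
`E`. -/
theorem exists_isMaximalSemireal_subfield {Ω : Type*} [Field Ω] [IsAlgClosed Ω] (E₀ : Subfield Ω)
    (h₀ : ¬ IsSumSq (-1 : E₀)) : ∃ E : Subfield Ω, E₀ ≤ E ∧ IsMaximalSemireal E := by
  obtain ⟨E, hE₀, hE⟩ := zorn_le_nonempty₀ {E : Subfield Ω | ¬ IsSumSq (-1 : E)} (by
    intro c hc hchain E hEc
    refine ⟨sSup c, fun hs => ?_, fun E hE => le_sSup hE⟩
    obtain ⟨E', hE', t, ht, hts⟩ := Subfield.exists_isSumSq_of_sSup hchain.directedOn ⟨E, hEc⟩ hs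
    refine hc hE' ?_
    have : t = -1 := Subtype.ext (by simpa using hts)
    rwa [← this]) E₀ h₀
  refine ⟨E, hE₀, hE.prop, fun f hf hs => ?_⟩
  have : Fact (Irreducible f) := ⟨hf⟩
  obtain ⟨θ, hθ⟩ := IsAlgClosed.exists_eval₂_eq_zero E.subtype f (degree_pos_of_irreducible hf).ne'
  let g : AdjoinRoot f →+* Ω := AdjoinRoot.lift E.subtype θ hθ
  have hER : E ≤ g.fieldRange := fun x hx =>
    ⟨AdjoinRoot.of f ⟨x, hx⟩, AdjoinRoot.lift_of hθ⟩
  have hR : ¬ IsSumSq (-1 : g.fieldRange) := by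
    intro h
    let e := RingEquiv.ofBijective g.rangeRestrictField
      ⟨g.rangeRestrictField.injective, g.rangeRestrict_surjective⟩
    have := h.map e.symm.toRingHom
    rw [map_neg, map_one] at this
    exact hs this
  have hθE : θ ∈ E := hE.le_of_ge hR hER ⟨AdjoinRoot.root f, AdjoinRoot.lift_root hθ⟩
  refine ⟨⟨θ, hθE⟩, ?_⟩
  have := hom_eval₂ f (RingHom.id E) E.subtype ⟨θ, hθE⟩
  rw [RingHom.comp_id] at this
  exact E.subtype.injective (by rw [map_zero, eval, this]; exact hθ)

end Maximal

/-! ### Ordering and intermediate values in maximal semireal fields. -/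

namespace IsMaximalSemireal

variable {K : Type*} [Field K]

theorem isSumSq_mul_self_inv {s : K} (hs : IsSumSq s) : IsSumSq s⁻¹ := by
  by_cases h : s = 0
  · rw [h, inv_zero]; exact .zero
  · have : s⁻¹ = s * (s⁻¹ * s⁻¹) := by field_simp
    rw [this]
    exact hs.mul (.mul_self _)

/-- Expand squares of `u√a + v`. Only the shape of the rational part matters; `d` is left free. -/
theorem exists_isSumSq_add_mul {a : K} {s : AdjoinRoot (X ^ 2 - C a)} (hs : IsSumSq s) :
    ∃ b c d : K, IsSumSq b ∧ IsSumSq c ∧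
      s = AdjoinRoot.of _ (b + a * c) + AdjoinRoot.of _ d * AdjoinRoot.root _ := by
  have hroot : AdjoinRoot.root (X ^ 2 - C a) ^ 2 = AdjoinRoot.of _ a := by
    have := AdjoinRoot.eval₂_root (X ^ 2 - C a)
    simpa [sub_eq_zero] using this
  induction hs with
  | zero => exact ⟨0, 0, 0, .zero, .zero, by simp⟩
  | @sq_add x s hs ih =>
    obtain ⟨b, c, d, hb, hc, rfl⟩ := ih
    obtain ⟨p, rfl⟩ := AdjoinRoot.mk_surjective x
    have hmonic : (X ^ 2 - C a).Monic := monic_X_pow_sub_C a two_ne_zero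
    have hdeg : (p %ₘ (X ^ 2 - C a)).natDegree < 2 := by
      have := natDegree_modByMonic_lt p hmonic (by
        intro h
        have := congrArg natDegree h
        simp at this)
      rwa [natDegree_X_pow_sub_C] at this
    have hp : AdjoinRoot.mk (X ^ 2 - C a) p = AdjoinRoot.mk (X ^ 2 - C a) (p %ₘ (X ^ 2 - C a)) := by
      rw [AdjoinRoot.mk_eq_mk]
      exact ⟨p /ₘ (X ^ 2 - C a), by linear_combination -(modByMonic_add_div p (X ^ 2 - C a))⟩
    obtain ⟨u, v, huv⟩ := exists_eq_X_add_C_of_natDegree_le_one (Nat.le_of_lt_succ hdeg)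
    rw [hp, huv]
    refine ⟨v * v + b, u * u + c, 2 * u * v + d, .sq_add _ hb, .sq_add _ hc, ?_⟩
    simp only [map_add, map_mul, AdjoinRoot.mk_C, AdjoinRoot.mk_X, map_ofNat]
    linear_combination (AdjoinRoot.of (X ^ 2 - C a) u) ^ 2 * hroot

/-- If `a` is not a square, adjoining `√a` destroys semireality. So `-1 = b + a c` with `b`, `c`
sums of squares, `c ≠ 0`, and `-a = (1 + b) / c`. -/
theorem isSquare_or_isSumSq_neg (hK : IsMaximalSemireal K) (a : K) :
    IsSquare a ∨ IsSumSq (-a) := by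
  by_contra! hcon
  obtain ⟨ha, hna⟩ := hcon
  have hnr : ∀ x : K, (X ^ 2 - C a : K[X]).eval x ≠ 0 := fun x hx => ha ⟨x, by
    simp [sub_eq_zero] at hx
    rw [← hx, sq]⟩
  have hirr : Irreducible (X ^ 2 - C a : K[X]) := by
    rw [(monic_X_pow_sub_C a two_ne_zero).irreducible_iff_roots_eq_zero_of_degree_le_three
      (by rw [natDegree_X_pow_sub_C]) (by rw [natDegree_X_pow_sub_C]; norm_num)]
    refine Multiset.eq_zero_of_forall_notMem fun x hx => hnr x ?_
    exact (mem_roots'.1 hx).2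
  have hsum : IsSumSq (-1 : AdjoinRoot (X ^ 2 - C a)) := by
    by_contra h
    obtain ⟨x, hx⟩ := hK.exists_root _ hirr h
    exact hnr x hx
  obtain ⟨b, c, d, hb, hc, h⟩ := exists_isSumSq_add_mul hsum
  have hdvd : (X ^ 2 - C a : K[X]) ∣ C d * X + C (1 + (b + a * c)) := by
    rw [← AdjoinRoot.mk_eq_zero]
    simp only [map_add, map_mul, AdjoinRoot.mk_C, AdjoinRoot.mk_X, map_one] at h ⊢
    linear_combination -h
  have h0 := eq_zero_of_dvd_of_natDegree_lt hdvd (by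
    rw [natDegree_X_pow_sub_C]
    exact natDegree_linear_le.trans_lt one_lt_two)
  have h1 : 1 + (b + a * c) = 0 := by simpa using congrArg (fun p => coeff p 0) h0
  have hc0 : c ≠ 0 := by
    rintro rfl
    refine hK.not_isSumSq_neg_one ?_
    rw [mul_zero, add_zero, add_comm, add_eq_zero_iff_eq_neg] at h1
    rwa [← h1]
  apply hna
  have : -a = (1 * 1 + b) * c⁻¹ := by
    field_simp
    linear_combination -h1
  rw [this]
  exact (IsSumSq.sq_add 1 hb).mul (isSumSq_mul_self_inv hc)

theorem isSquare_of_isSumSq (hK : IsMaximalSemireal K) {a : K} (ha : IsSumSq a) :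
    IsSquare a := by
  rcases hK.isSquare_or_isSumSq_neg a with h | h
  · exact h
  · by_cases h0 : a = 0
    · exact ⟨0, by simp [h0]⟩
    · refine absurd ?_ hK.not_isSumSq_neg_one
      have : (-1 : K) = -a * a⁻¹ := by field_simp
      rw [this]
      exact h.mul (isSumSq_mul_self_inv ha)

/-- The cone of squares of a maximal semireal field. -/
def cone (hK : IsMaximalSemireal K) : RingCone K where
  carrier := {x | IsSquare x}
  mul_mem' ha hb := ha.mul hb
  one_mem' := IsSquare.one
  add_mem' ha hb := hK.isSquare_of_isSumSq (ha.isSumSq.add hb.isSumSq)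
  zero_mem' := IsSquare.zero
  eq_zero_of_mem_of_neg_mem' {a} ha hb := by
    by_contra h0
    refine hK.not_isSumSq_neg_one ?_
    have : (-1 : K) = -a * a⁻¹ := by field_simp
    rw [this]
    exact hb.isSumSq.mul (isSumSq_mul_self_inv ha.isSumSq)

instance (hK : IsMaximalSemireal K) : HasMemOrNegMem hK.cone where
  mem_or_neg_mem a := (hK.isSquare_or_isSumSq_neg a).imp id hK.isSquare_of_isSumSq

open scoped Classical in
/-- The ordering of a maximal semireal field. -/
@[reducible] def linearOrder (hK : IsMaximalSemireal K) : LinearOrder K :=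
  LinearOrder.mkOfAddGroupCone hK.cone

theorem isStrictOrderedRing (hK : IsMaximalSemireal K) :
    @IsStrictOrderedRing K _ hK.linearOrder.toPartialOrder := by
  let _ := hK.linearOrder
  have : IsOrderedRing K := IsOrderedRing.mkOfCone hK.cone
  exact IsOrderedRing.toIsStrictOrderedRing K

/-- Squaring representatives reduced modulo `f` keeps the degree small; this bound drives the
descent in `exists_root_of_eval_mul_neg`. -/
theorem exists_isSumSq_mk_eq {f : K[X]} (hf : f.natDegree ≠ 0) {s : AdjoinRoot f}
    (hs : IsSumSq s) :
    ∃ q : K[X], IsSumSq q ∧ q.natDegree ≤ 2 * (f.natDegree - 1) ∧ AdjoinRoot.mk f q = s := by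
  induction hs with
  | zero => exact ⟨0, .zero, by simp, by simp⟩
  | @sq_add x s hs ih =>
    obtain ⟨q, hq, hqd, rfl⟩ := ih
    obtain ⟨p, rfl⟩ := AdjoinRoot.mk_surjective x
    have hdeg := natDegree_mod_lt p hf
    have hp : AdjoinRoot.mk f p = AdjoinRoot.mk f (p % f) := by
      rw [AdjoinRoot.mk_eq_mk]
      exact ⟨p / f, by linear_combination -(EuclideanDomain.div_add_mod p f)⟩
    refine ⟨p % f * (p % f) + q, .sq_add _ hq, ?_, by rw [map_add, map_mul, ← hp]⟩
    refine (natDegree_add_le _ _).trans (max_le (natDegree_mul_le.trans ?_) hqd)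
    omega

theorem exists_irreducible_eval_mul_neg [LinearOrder K] [IsStrictOrderedRing K] {p : K[X]}
    {a b : K} (hp : p.eval a * p.eval b < 0) :
    ∃ f, Irreducible f ∧ f ∣ p ∧ f.eval a * f.eval b < 0 := by
  have hp0 : p ≠ 0 := by rintro rfl; simp at hp
  induction p using WfDvdMonoid.induction_on_irreducible with
  | zero => exact absurd rfl hp0
  | unit u hu =>
    obtain ⟨c, hc, rfl⟩ := Polynomial.isUnit_iff.1 hu
    simp only [eval_C] at hp
    exact absurd hp (mul_self_nonneg c).not_gt
  | mul q f hq hf ih =>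
    by_cases h : f.eval a * f.eval b < 0
    · exact ⟨f, hf, dvd_mul_right _ _, h⟩
    · have : q.eval a * q.eval b < 0 := by
        by_contra h'
        have := mul_nonneg (not_lt.1 h) (not_lt.1 h')
        simp only [eval_mul] at hp
        nlinarith
      obtain ⟨g, h1, h2, h3⟩ := ih this hq
      exact ⟨g, h1, h2.mul_left _, h3⟩

/-- An irreducible polynomial changing sign over a maximal semireal field has a root. -/
theorem exists_root_of_eval_mul_neg (hK : IsMaximalSemireal K) [LinearOrder K]
    [IsStrictOrderedRing K] {a b : K} (n : ℕ) : ∀ f : K[X], f.natDegree ≤ n → Irreducible f →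
      f.eval a * f.eval b < 0 → ∃ x, f.eval x = 0 := by
  induction n using Nat.strong_induction_on with
  | _ n ih =>
    intro f hfn hf hab
    by_contra hcon
    have hsum : IsSumSq (-1 : AdjoinRoot f) := by
      by_contra h
      exact hcon (hK.exists_root f hf h)
    have hfd : 0 < f.natDegree := hf.natDegree_pos
    obtain ⟨q, hq, hqd, hqs⟩ := exists_isSumSq_mk_eq hfd.ne' hsum
    have hpos : ∀ x, 0 < (1 + q).eval x := fun x => by
      have := (hq.map (evalRingHom x)).nonneg
      simp only [coe_evalRingHom] at this
      simp only [eval_add, eval_one]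
      linarith
    obtain ⟨h, hh⟩ : f ∣ 1 + q := by
      rw [← AdjoinRoot.mk_eq_zero, map_add, map_one, hqs, add_neg_cancel]
    have hh0 : h ≠ 0 := by
      rintro rfl
      have := hpos 0
      simp [hh] at this
    -- Since `1 + q = f * h` is positive everywhere, `h` must change sign along with `f`. It has
    -- smaller degree, and a root of one of its factors would contradict positivity.
    have hneg : h.eval a * h.eval b < 0 := by
      have h1 := mul_pos (hpos a) (hpos b)
      rw [hh, eval_mul, eval_mul] at h1
      have h2 : 0 < (f.eval a * f.eval b) * (h.eval a * h.eval b) := by linarith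
      by_contra h'
      exact h2.not_ge (mul_nonpos_of_nonpos_of_nonneg hab.le (not_lt.1 h'))
    have hdeg : h.natDegree < f.natDegree := by
      have h1 : (1 + q).natDegree ≤ 2 * (f.natDegree - 1) :=
        (natDegree_add_le _ _).trans (max_le (by simp) hqd)
      rw [hh, natDegree_mul hf.ne_zero hh0] at h1
      omega
    obtain ⟨g, hg, hgh, hgab⟩ := exists_irreducible_eval_mul_neg hneg
    obtain ⟨x, hx⟩ := ih h.natDegree (hdeg.trans_le hfn) g (natDegree_le_of_dvd hgh hh0) hg hgab
    refine (hpos x).ne' ?_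
    rw [hh, eval_mul]
    obtain ⟨r, rfl⟩ := hgh
    rw [eval_mul, hx, zero_mul, mul_zero]

/-- An irreducible factor that changes sign has a root, hence is linear, and its sign change places
that root between `a` and `b`. -/
theorem polyIVT (hK : IsMaximalSemireal K) [LinearOrder K] [IsStrictOrderedRing K] :
    PolyIVT K where
  exists_root_of_neg_of_pos p a b hab ha hb := by
    obtain ⟨f, hf, hfp, hfab⟩ := exists_irreducible_eval_mul_neg (mul_neg_of_neg_of_pos ha hb)
    obtain ⟨x, hx⟩ := hK.exists_root_of_eval_mul_neg _ f le_rfl hf hfab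
    obtain ⟨c, hc⟩ : ∃ c, f = (X - C x) * C c := by
      obtain ⟨r, hr⟩ := dvd_iff_isRoot.2 hx
      have := (hf.isUnit_or_isUnit hr).resolve_left (not_isUnit_X_sub_C x)
      obtain ⟨c, -, rfl⟩ := Polynomial.isUnit_iff.1 this
      exact ⟨c, hr⟩
    have hc2 : (a - x) * (b - x) * (c * c) < 0 := by
      rw [hc] at hfab
      simp only [eval_mul, eval_sub, eval_X, eval_C] at hfab
      linarith
    have h3 : (a - x) * (b - x) < 0 := by
      by_contra h
      exact absurd hc2 (mul_nonneg (not_lt.1 h) (mul_self_nonneg c)).not_gt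
    refine ⟨x, ?_, ?_, ?_⟩
    · rcases mul_neg_iff.1 h3 with h | h
      · linarith [h.1, h.2]
      · linarith [h.1, h.2]
    · rcases mul_neg_iff.1 h3 with h | h
      · linarith [h.1, h.2]
      · linarith [h.1, h.2]
    · obtain ⟨r, rfl⟩ := hfp
      rw [eval_mul, hx, zero_mul]

end IsMaximalSemireal

-- Artin–Lang specialization.

universe u

/-- A semireal field embeds in an ordered field with the intermediate value property for
polynomials. -/
theorem exists_ringHom_polyIVT {F : Type u} [Field F] (hF : ¬ IsSumSq (-1 : F)) :
    ∃ (K : Type u) (_ : Field K) (_ : LinearOrder K), IsStrictOrderedRing K ∧ PolyIVT K ∧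
      Nonempty (F →+* K) := by
  let i := algebraMap F (AlgebraicClosure F)
  obtain ⟨E, hE₀, hE⟩ := exists_isMaximalSemireal_subfield i.fieldRange (by
    intro h
    let e := RingEquiv.ofBijective i.rangeRestrictField
      ⟨i.rangeRestrictField.injective, i.rangeRestrict_surjective⟩
    have := h.map e.symm.toRingHom
    rw [map_neg, map_one] at this
    exact hF this)
  let _ := hE.linearOrder
  have := hE.isStrictOrderedRing
  exact ⟨E, inferInstance, hE.linearOrder, this, hE.polyIVT,
    ⟨(Subfield.inclusion hE₀).comp i.rangeRestrictField⟩⟩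

/-- Finitely many sign conditions at a point with coordinates in a semireal extension field of `ℝ`
are realized at a point with real coordinates. -/
theorem exists_eval_eq_zero_and_ne_zero {F : Type*} [Field F] (hF : ¬ IsSumSq (-1 : F)) {n : ℕ}
    (g : MvPolynomial (Fin n) ℝ →+* F) (P Q : Finset (MvPolynomial (Fin n) ℝ))
    (hP : ∀ p ∈ P, g p = 0) (hQ : ∀ q ∈ Q, g q ≠ 0) :
    ∃ x : Fin n → ℝ, (∀ p ∈ P, MvPolynomial.eval x p = 0) ∧
      ∀ q ∈ Q, MvPolynomial.eval x q ≠ 0 := by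
  classical
  obtain ⟨K, _, _, _, _, ⟨i⟩⟩ := exists_ringHom_polyIVT hF
  have he : MvPolynomial.eval₂Hom ((i.comp g).comp MvPolynomial.C)
      (fun k => i (g (MvPolynomial.X k))) = i.comp g := by
    apply MvPolynomial.ringHom_ext <;> simp
  obtain ⟨β, hβ⟩ := hasRealSignApproximations_mvPolynomial n ((i.comp g).comp MvPolynomial.C)
    (fun k => i (g (MvPolynomial.X k))) (P ∪ Q)
  rw [he] at hβ
  -- The identity is the only ring endomorphism of `ℝ`, so `β` is evaluation at a real point.
  have hβe : MvPolynomial.eval (fun k => β (MvPolynomial.X k)) = β := by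
    apply MvPolynomial.ringHom_ext
    · intro r
      rw [MvPolynomial.eval_C]
      exact (DFunLike.congr_fun (Subsingleton.elim (β.comp MvPolynomial.C) (RingHom.id ℝ)) r).symm
    · simp
  refine ⟨fun k => β (MvPolynomial.X k), fun p hp => ?_, fun q hq => ?_⟩
  · rw [hβe, ← sign_eq_zero_iff, hβ p (Finset.mem_union_left _ hp)]
    simp [hP p hp]
  · rw [hβe, ← sign_ne_zero, hβ q (Finset.mem_union_right _ hq), sign_ne_zero]
    simpa using hQ q hq
end

/-! ## Complex points of integral extensions -/

noncomputable section

open Polynomial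

/-- A ring homomorphism to `ℂ` extends along an integral homomorphism, with prescribed vanishing on
an ideal whose contraction it kills. -/
theorem RingHom.IsIntegral.exists_extension_complex {R S : Type*} [CommRing R] [CommRing S]
    {f : R →+* S} (hf : f.IsIntegral) (I : Ideal S) (ψ : R →+* ℂ)
    (hI : I.comap f ≤ RingHom.ker ψ) :
    ∃ Ψ : S →+* ℂ, (∀ r, Ψ (f r) = ψ r) ∧ ∀ s ∈ I, Ψ s = 0 := by
  let _ := f.toAlgebra
  have hint : Algebra.IsIntegral R S := ⟨hf⟩
  have hprime : (RingHom.ker ψ).IsPrime := RingHom.ker_isPrime ψ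
  obtain ⟨Q, hQI, hQ, hQψ⟩ := Ideal.exists_ideal_over_prime_of_isIntegral (RingHom.ker ψ) I hI
  let R' := R ⧸ Q.comap (algebraMap R S)
  have hmem : ∀ r, r ∈ Q.comap (algebraMap R S) ↔ ψ r = 0 := fun r => by rw [hQψ]; rfl
  let ψ' : R' →+* ℂ := Ideal.Quotient.lift _ ψ fun r hr => (hmem r).1 hr
  have hψ' : Function.Injective ψ' := (injective_iff_map_eq_zero _).2 fun x => by
    obtain ⟨r, rfl⟩ := Ideal.Quotient.mk_surjective x
    intro h
    exact Ideal.Quotient.eq_zero_iff_mem.2 ((hmem r).2 h)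
  let _ : Algebra R' ℂ := ψ'.toAlgebra
  have : (Q.comap (algebraMap R S)).IsPrime := Ideal.comap_isPrime _ _
  have : FaithfulSMul R' ℂ := (faithfulSMul_iff_algebraMap_injective _ _).2 hψ'
  have : Module.IsTorsionFree R' ℂ := inferInstance
  have : FaithfulSMul R' (S ⧸ Q) :=
    (faithfulSMul_iff_algebraMap_injective _ _).2 Ideal.algebraMap_quotient_injective
  have : Module.IsTorsionFree R' (S ⧸ Q) := .trans_faithfulSMul R' (S ⧸ Q) (S ⧸ Q)
  have : Algebra.IsIntegral R' (S ⧸ Q) := inferInstance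
  let Φ : S ⧸ Q →ₐ[R'] ℂ := IsAlgClosed.lift
  refine ⟨Φ.toRingHom.comp (Ideal.Quotient.mk Q), fun r => ?_, fun s hs => ?_⟩
  · exact Φ.commutes (Ideal.Quotient.mk _ r)
  · simp [Ideal.Quotient.eq_zero_iff_mem.2 (hQI hs)]

/-- Up to a denominator, every element of an integral extension of domains is annihilated by a
monic polynomial that divides all its annihilating polynomials. -/
theorem RingHom.IsIntegral.exists_monic_dvd {R S : Type*} [CommRing R] [IsDomain R] [CommRing S]
    [IsDomain S] {f : R →+* S} (hf : f.IsIntegral) (hinj : Function.Injective f) (b : S) :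
    ∃ s : R, s ≠ 0 ∧ ∃ h : R[X], h.Monic ∧ h.eval₂ f (f s * b) = 0 ∧
      ∀ p : R[X], p.eval₂ f (f s * b) = 0 → h ∣ p := by
  classical
  -- `R` need not be integrally closed, so the degree is minimized over all multiples of `b` by
  -- nonzero `s` as well.
  have hex : ∃ d, ∃ s : R, s ≠ 0 ∧ ∃ h : R[X], h.Monic ∧ h.eval₂ f (f s * b) = 0 ∧
      h.natDegree = d := by
    obtain ⟨h, h1, h2⟩ := hf b
    exact ⟨_, 1, one_ne_zero, h, h1, by simpa using h2, rfl⟩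
  obtain ⟨s, hs, h, hmon, hroot, hdeg⟩ := Nat.find_spec hex
  refine ⟨s, hs, h, hmon, hroot, fun p hp => ?_⟩
  rw [← modByMonic_eq_zero_iff_dvd hmon]
  by_contra hne
  set r := p %ₘ h with hr
  have hr0 : r.eval₂ f (f s * b) = 0 := by
    rw [hr, modByMonic_eq_sub_mul_div p, eval₂_sub, eval₂_mul, hp, hroot, zero_mul, sub_zero]
  have hlt : r.natDegree < h.natDegree := by
    refine natDegree_modByMonic_lt p hmon ?_
    rintro rfl
    simp at hroot
  -- Multiplying by the leading coefficient of the remainder turns it into a monic annihilator of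
  -- smaller degree.
  refine Nat.find_min hex (hdeg ▸ hlt) ⟨r.leadingCoeff * s,
    mul_ne_zero (leadingCoeff_ne_zero.2 hne) hs, r.integralNormalization,
    monic_integralNormalization hne, ?_, natDegree_integralNormalization⟩
  rw [map_mul, mul_assoc]
  exact integralNormalization_eval₂_eq_zero f hr0 fun x hx => hinj (by rw [hx, map_zero])

theorem Polynomial.eq_X_sub_C_pow_of_forall_root_eq {h : ℂ[X]} (hm : h.Monic) {c : ℂ}
    (hc : ∀ t, h.eval t = 0 → t = c) : h = (X - C c) ^ h.natDegree := by
  have hs := IsAlgClosed.splits h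
  have hroots : h.roots = Multiset.replicate h.natDegree c := by
    refine Multiset.eq_replicate.2 ⟨hs.natDegree_eq_card_roots.symm, fun t ht => hc t ?_⟩
    exact (mem_roots'.1 ht).2
  conv_lhs => rw [hs.eq_prod_roots_of_monic hm, hroots]
  simp

/-- If an integral extension of domains has only one complex point over each point of a separating
set of complex points, then it is birational. -/
theorem RingHom.IsIntegral.exists_mul_eq {R S ι : Type*} [CommRing R] [IsDomain R] [CharZero R]
    [CommRing S] [IsDomain S] {f : R →+* S} (hf : f.IsIntegral) (hinj : Function.Injective f)
    (ev : ι → R →+* ℂ) (hev : ∀ r, (∀ i, ev i r = 0) → r = 0)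
    (huniq : ∀ i (Ψ₁ Ψ₂ : S →+* ℂ), (∀ r, Ψ₁ (f r) = ev i r) → (∀ r, Ψ₂ (f r) = ev i r) → Ψ₁ = Ψ₂)
    (b : S) : ∃ s r : R, s ≠ 0 ∧ f s * b = f r := by
  obtain ⟨s, hs, h, hmon, hroot, hdvd⟩ := hf.exists_monic_dvd hinj b
  have hd0 : h.natDegree ≠ 0 := by
    intro h0
    rw [eq_one_of_monic_natDegree_zero hmon h0] at hroot
    simp at hroot
  let j : AdjoinRoot h →+* S := AdjoinRoot.lift f (f s * b) hroot
  have hj : ∀ r, j (AdjoinRoot.of h r) = f r := fun r => AdjoinRoot.lift_of hroot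
  have hjint : j.IsIntegral := RingHom.IsIntegral.tower_top (AdjoinRoot.of h) j (by
    have : j.comp (AdjoinRoot.of h) = f := RingHom.ext hj
    rwa [this])
  have hjinj : Function.Injective j := (injective_iff_map_eq_zero _).2 fun x => by
    obtain ⟨p, rfl⟩ := AdjoinRoot.mk_surjective x
    intro hx
    rw [AdjoinRoot.lift_mk] at hx
    exact AdjoinRoot.mk_eq_zero.2 (hdvd p hx)
  -- `R[X]/(h)` embeds in `S` because `h` divides every annihilator. So each root of a
  -- specialization of `h` is the value of `f s * b` at some complex point of `S`.
  have hext : ∀ i t, (h.map (ev i)).eval t = 0 →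
      ∃ Ψ : S →+* ℂ, (∀ r, Ψ (f r) = ev i r) ∧ Ψ (f s * b) = t := by
    intro i t ht
    rw [eval_map] at ht
    obtain ⟨Ψ, hΨ, -⟩ := hjint.exists_extension_complex ⊥ (AdjoinRoot.lift (ev i) t ht) (by
      intro x hx
      rw [Ideal.mem_comap, Ideal.mem_bot, map_eq_zero_iff j hjinj] at hx
      simp [hx])
    refine ⟨Ψ, fun r => ?_, ?_⟩
    · rw [← hj, hΨ, AdjoinRoot.lift_of]
    · have := hΨ (AdjoinRoot.root h)
      rwa [AdjoinRoot.lift_root, AdjoinRoot.lift_root] at this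
  set d := h.natDegree
  -- The factor `d ^ d` clears the denominator of the mean of the roots, `-h.nextCoeff / d`. The
  -- identity is checked at each `ev i`, where uniqueness leaves a single root `c`.
  have key : C (d : R) ^ d * h = (C (d : R) * X + C h.nextCoeff) ^ d := by
    refine Polynomial.ext fun k => sub_eq_zero.1 (hev _ fun i => ?_)
    rw [map_sub, ← coeff_map, ← coeff_map, sub_eq_zero]
    congr 1
    obtain ⟨c, hc⟩ : ∃ c, ∀ t, (h.map (ev i)).eval t = 0 → t = c := by
      by_cases h0 : ∃ c, (h.map (ev i)).eval c = 0
      · obtain ⟨c, hc⟩ := h0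
        obtain ⟨Ψ, h1, rfl⟩ := hext i c hc
        refine ⟨Ψ (f s * b), fun t ht => ?_⟩
        obtain ⟨Ψ', h1', rfl⟩ := hext i t ht
        rw [huniq i Ψ' Ψ h1' h1]
      · exact ⟨0, fun t ht => absurd ⟨t, ht⟩ h0⟩
    have hpow := eq_X_sub_C_pow_of_forall_root_eq (hmon.map (ev i)) hc
    rw [hmon.natDegree_map] at hpow
    have hnext : ev i h.nextCoeff = -(d * c) := by
      have h1 : (h.map (ev i)).nextCoeff = ev i h.nextCoeff := by
        rw [nextCoeff_of_natDegree_pos, nextCoeff_of_natDegree_pos, coeff_map, hmon.natDegree_map]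
        · exact Nat.pos_of_ne_zero hd0
        · rw [hmon.natDegree_map]; exact Nat.pos_of_ne_zero hd0
      rw [← h1, hpow, (monic_X_sub_C c).nextCoeff_pow, nextCoeff_X_sub_C, nsmul_eq_mul, mul_neg]
    simp only [Polynomial.map_mul, Polynomial.map_pow, Polynomial.map_add, map_C, map_X, hnext,
      map_natCast, Polynomial.map_natCast]
    rw [hpow, ← mul_pow]
    congr 1
    simp only [map_neg, map_mul, map_natCast]
    ring
  have hS := congrArg (eval₂ f (f s * b)) key
  simp only [eval₂_mul, eval₂_pow, eval₂_add, eval₂_C, eval₂_X, hroot, mul_zero] at hS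
  refine ⟨d * s, -h.nextCoeff, mul_ne_zero (Nat.cast_ne_zero.2 hd0) hs, ?_⟩
  have := pow_eq_zero_iff hd0 |>.1 hS.symm
  rw [map_mul, map_neg]
  linear_combination this

namespace RealAlg

theorem inducesFractionIso_of_forall_exists_mul_eq {R S : Type*} [CommRing R] [IsDomain R]
    [CommRing S] [IsDomain S] {f : R →+* S} (hinj : Function.Injective f)
    (hf : ∀ b, ∃ s r : R, s ≠ 0 ∧ f s * b = f r) : InducesFractionIso f := by
  have h : nonZeroDivisors R ≤ (nonZeroDivisors S).comap f := fun r hr =>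
    mem_nonZeroDivisors_of_ne_zero ((map_ne_zero_iff f hinj).2 (nonZeroDivisors.ne_zero hr))
  refine ⟨h, RingHom.injective _, ?_⟩
  have key : ∀ b : S, ∃ x, (IsLocalization.map (FractionRing S) f h :
      FractionRing R →+* FractionRing S) x = algebraMap S (FractionRing S) b := by
    intro b
    obtain ⟨s, r, hs, hb⟩ := hf b
    refine ⟨algebraMap R _ r / algebraMap R _ s, ?_⟩
    have hs' : algebraMap S (FractionRing S) (f s) ≠ 0 := by
      rw [map_ne_zero_iff _ (IsFractionRing.injective S (FractionRing S)), map_ne_zero_iff f hinj]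
      exact hs
    rw [map_div₀, IsLocalization.map_eq, IsLocalization.map_eq, div_eq_iff hs', ← map_mul, ← hb,
      mul_comm]
  intro y
  obtain ⟨c, d, -, rfl⟩ := IsFractionRing.div_surjective (A := S) y
  obtain ⟨u, hu⟩ := key c
  obtain ⟨v, hv⟩ := key d
  exact ⟨u / v, by rw [map_div₀, hu, hv]⟩

end RealAlg
end

/-! ## Finite birational maps onto sets with a totally real normalization -/

noncomputable section

namespace RealAlg

variable {n m : ℕ}

/-- The polynomial function on `X` defined by a polynomial. -/
def ofPoly (X : Set (Fin n → ℝ)) : MvPolynomial (Fin n) ℝ →ₐ[ℝ] Pol X :=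
  (MvPolynomial.aeval fun (i : Fin n) (x : X) => x.1 i).rangeRestrict

theorem ofPoly_apply (X : Set (Fin n → ℝ)) (p : MvPolynomial (Fin n) ℝ) (x : X) :
    (ofPoly X p).1 x = MvPolynomial.eval x.1 p :=
  aeval_coord_apply X p x

theorem ofPoly_surjective (X : Set (Fin n → ℝ)) : Function.Surjective (ofPoly X) :=
  AlgHom.rangeRestrict_surjective _

theorem Pol.ext {X : Set (Fin n → ℝ)} {f g : Pol X} (h : ∀ x, f.1 x = g.1 x) : f = g :=
  Subtype.ext (funext h)

theorem Pol.continuous {X : Set (Fin n → ℝ)} (f : Pol X) : Continuous f.1 := by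
  obtain ⟨p, rfl⟩ := ofPoly_surjective X f
  have : (ofPoly X p).1 = fun x : X => MvPolynomial.eval x.1 p := funext (ofPoly_apply X p)
  rw [this]
  exact (MvPolynomial.continuous_eval p).comp continuous_subtype_val

/-- The ideal of the polynomial functions on `X` that vanish on a subset. -/
def vanishingIdeal {X : Set (Fin n → ℝ)} (S : Set X) : Ideal (Pol X) where
  carrier := {f | ∀ x ∈ S, f.1 x = 0}
  add_mem' {f g} hf hg x hx := by
    change f.1 x + g.1 x = 0
    rw [hf x hx, hg x hx, add_zero]
  zero_mem' _ _ := rfl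
  smul_mem' c f hf x hx := by
    change c.1 x * f.1 x = 0
    rw [hf x hx, mul_zero]

theorem Pol.sum_sq_apply {X : Set (Fin n → ℝ)} {k : ℕ} (a : Fin k → Pol X) (x : X) :
    (∑ i, a i ^ 2).1 x = ∑ i, (a i).1 x ^ 2 := by
  simp

theorem isRealIdeal_vanishingIdeal {X : Set (Fin n → ℝ)} (S : Set X) :
    IsRealIdeal (vanishingIdeal S) := by
  intro k a h i x hx
  have h1 := h x hx
  rw [Pol.sum_sq_apply, Finset.sum_eq_zero_iff_of_nonneg fun i _ => sq_nonneg _] at h1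
  exact pow_eq_zero_iff two_ne_zero |>.1 (h1 i (Finset.mem_univ i))

theorem isClosed_zariski_iff {Z : Set (Fin n → ℝ)} :
    IsClosed[zariski n] Z ↔ IsAlgebraicSet Z := by
  rw [← @isOpen_compl_iff _ _ (zariski n)]
  change Zᶜᶜ ∈ _ ↔ _
  rw [compl_compl]
  rfl

/-- Expresses Zariski closedness by `Pol X` alone, so that it can be carried along `pullback`. -/
theorem isClosed_zariskiOn_iff {X : Set (Fin n → ℝ)} {S : Set X} :
    IsClosed[zariskiOn X] S ↔ ∀ x, (∀ f ∈ vanishingIdeal S, f.1 x = 0) → x ∈ S := by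
  rw [@isClosed_induced_iff _ _ (zariski n)]
  constructor
  · rintro ⟨Z, hZ, rfl⟩ x hx
    obtain ⟨T, rfl⟩ := isClosed_zariski_iff.1 hZ
    intro p hp
    rw [← ofPoly_apply X]
    refine hx _ fun y hy => ?_
    rw [ofPoly_apply X]
    exact hy p hp
  · intro h
    refine ⟨zeroSet {p | ofPoly X p ∈ vanishingIdeal S}, isClosed_zariski_iff.2 ⟨_, rfl⟩, ?_⟩
    ext x
    constructor
    · intro hx
      refine h x fun f hf => ?_
      obtain ⟨p, rfl⟩ := ofPoly_surjective X f
      rw [ofPoly_apply]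
      exact hx p hf
    · intro hx p hp
      rw [← ofPoly_apply X]
      exact hp x hx

theorem IsAlgebraicSet.isClosed {X : Set (Fin n → ℝ)} (hX : IsAlgebraicSet X) : IsClosed X := by
  obtain ⟨S, rfl⟩ := hX
  have : zeroSet S = ⋂ p ∈ S, {x | MvPolynomial.eval x p = 0} := by
    ext x
    simp [zeroSet]
  rw [this]
  exact isClosed_biInter fun p _ =>
    isClosed_eq (MvPolynomial.continuous_eval p) continuous_const

variable {X : Set (Fin n → ℝ)} {Y : Set (Fin m → ℝ)}

theorem PolynomialMap.pullback_apply (φ : PolynomialMap Y X) (f : Pol X) (y : Y) :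
    (φ.pullback f).1 y = f.1 (φ.toFun y) :=
  rfl

theorem PolynomialMap.continuous (φ : PolynomialMap Y X) : Continuous φ.toFun :=
  Continuous.subtype_mk (continuous_pi fun i => Pol.continuous ⟨_, φ.polynomial i⟩) _

theorem PolynomialMap.IsFinite.isIntegral {φ : PolynomialMap Y X} (hφ : φ.IsFinite) :
    φ.pullback.toRingHom.IsIntegral :=
  RingHom.Finite.to_isIntegral hφ

theorem PolynomialMap.pullback_injective {φ : PolynomialMap Y X}
    (hφ : Function.Surjective φ.toFun) : Function.Injective φ.pullback := by
  intro f g h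
  refine Pol.ext fun x => ?_
  obtain ⟨y, rfl⟩ := hφ x
  rw [← φ.pullback_apply, h, φ.pullback_apply]

/-- A finite birational map embeds the polynomial functions on its source in the integral closure
of those on its target. -/
theorem PolynomialMap.exists_ringHom_normalization {φ : PolynomialMap Y X} (hfin : φ.IsFinite)
    (hbir : φ.IsBirational) :
    ∃ j : Pol Y →+* Normalization (Pol X), Function.Injective j ∧
      ∀ f, j (φ.pullback f) = algebraMap (Pol X) (Normalization (Pol X)) f := by
  obtain ⟨h, hbij⟩ := hbir
  let e := RingEquiv.ofBijective _ hbij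
  let j₀ : Pol Y →+* FractionRing (Pol X) :=
    e.symm.toRingHom.comp (algebraMap (Pol Y) (FractionRing (Pol Y)))
  have hj₀ : ∀ f, j₀ (φ.pullback f) = algebraMap (Pol X) (FractionRing (Pol X)) f := by
    intro f
    refine e.symm_apply_eq.2 ?_
    exact (IsLocalization.map_eq h f).symm
  have hint : ∀ b, j₀ b ∈ integralClosure (Pol X) (FractionRing (Pol X)) := by
    intro b
    obtain ⟨p, hp, hpb⟩ := hfin.isIntegral b
    refine ⟨p, hp, ?_⟩
    have h1 := congrArg j₀ hpb
    rw [Polynomial.hom_eval₂, map_zero] at h1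
    have h2 : j₀.comp φ.pullback.toRingHom = algebraMap (Pol X) (FractionRing (Pol X)) :=
      RingHom.ext hj₀
    rwa [h2] at h1
  refine ⟨j₀.codRestrict _ hint, fun a b hab => ?_, fun f => Subtype.ext (hj₀ f)⟩
  have h1 : j₀ a = j₀ b := congrArg Subtype.val hab
  exact IsFractionRing.injective (Pol Y) (FractionRing (Pol Y)) (e.symm.injective h1)

/-- If `X` has a totally real normalization, the complex points over a point of `X` of a finite
birational real algebraic set are real. -/
theorem PolynomialMap.exists_point (hY : IsAlgebraicSet Y) (hN : HasTotallyRealNormalization X)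
    {φ : PolynomialMap Y X} (hfin : φ.IsFinite) (hbir : φ.IsBirational) {x : X}
    {Ψ : Pol Y →+* ℂ} (hΨ : ∀ f, Ψ (φ.pullback f) = f.1 x) :
    ∃ y, φ.toFun y = x ∧ ∀ g, Ψ g = (g.1 y : ℂ) := by
  obtain ⟨j, hj, hjφ⟩ := exists_ringHom_normalization hfin hbir
  have hjint : j.IsIntegral := by
    refine RingHom.IsIntegral.tower_top φ.pullback.toRingHom j ?_
    have : j.comp φ.pullback.toRingHom = algebraMap (Pol X) (Normalization (Pol X)) :=
      RingHom.ext hjφ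
    rw [this]
    exact Algebra.IsIntegral.isIntegral
  obtain ⟨Φ, hΦ, -⟩ := hjint.exists_extension_complex ⊥ Ψ (by
    intro b hb
    rw [Ideal.mem_comap, Ideal.mem_bot, map_eq_zero_iff j hj] at hb
    simp [hb])
  have hΦX : ∀ f, Φ (algebraMap (Pol X) (Normalization (Pol X)) f) = f.1 x := fun f => by
    rw [← hjφ, hΦ, hΨ]
  let Φ' : ComplexPoint (Normalization (Pol X)) :=
    { Φ with commutes' := fun r => hΦX (algebraMap ℝ (Pol X) r) }
  have hmem : Φ' ∈ complexNormalizationMap (Pol X) ⁻¹' Set.range (evalPoint (X := X)) :=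
    ⟨x, AlgHom.ext fun f => (hΦX f).symm⟩
  rw [hN] at hmem
  have him : ∀ b, (Ψ b).im = 0 := fun b => by
    rw [← hΦ]
    exact hmem (j b)
  -- `Ψ` takes real values because its extension to the normalization does; the candidate point is
  -- read off the coordinate functions.
  let y : Fin m → ℝ := fun i => (Ψ (ofPoly Y (MvPolynomial.X i))).re
  have hy : ∀ p, Ψ (ofPoly Y p) = (MvPolynomial.eval y p : ℝ) := by
    intro p
    have : Ψ.comp (ofPoly Y).toRingHom = Complex.ofRealHom.comp (MvPolynomial.eval y) := by
      apply MvPolynomial.ringHom_ext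
      · intro r
        have h1 : ofPoly Y (MvPolynomial.C r) = φ.pullback (algebraMap ℝ (Pol X) r) := by
          rw [AlgHom.commutes]
          exact (ofPoly Y).commutes r
        simp only [RingHom.comp_apply, AlgHom.toRingHom_eq_coe, RingHom.coe_coe, h1, hΨ,
          MvPolynomial.eval_C]
        rfl
      · intro i
        simp only [RingHom.comp_apply, AlgHom.toRingHom_eq_coe, RingHom.coe_coe,
          MvPolynomial.eval_X]
        exact Complex.ext rfl (him _)
    exact RingHom.congr_fun this p
  have hyY : y ∈ Y := by
    obtain ⟨S, rfl⟩ := hY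
    intro p hp
    have h0 : ofPoly (zeroSet S) p = 0 := Pol.ext fun z => by
      rw [ofPoly_apply]
      exact z.2 p hp
    have := hy p
    rw [h0, map_zero] at this
    exact_mod_cast this.symm
  have hyg : ∀ g, Ψ g = (g.1 ⟨y, hyY⟩ : ℂ) := by
    intro g
    obtain ⟨p, rfl⟩ := ofPoly_surjective Y g
    rw [hy, ofPoly_apply]
  refine ⟨⟨y, hyY⟩, Subtype.ext (funext fun i => ?_), hyg⟩
  have h1 := hΨ (ofPoly X (MvPolynomial.X i))
  rw [hyg, φ.pullback_apply, ofPoly_apply, ofPoly_apply, MvPolynomial.eval_X,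
    MvPolynomial.eval_X] at h1
  exact_mod_cast h1

/-- Every point of `X` at which the contraction of an ideal vanishes is the image of a point at
which the ideal vanishes. -/
theorem PolynomialMap.exists_point_of_comap_le (hY : IsAlgebraicSet Y)
    (hN : HasTotallyRealNormalization X) {φ : PolynomialMap Y X} (hfin : φ.IsFinite)
    (hbir : φ.IsBirational) (I : Ideal (Pol Y)) {x : X}
    (hx : ∀ f, φ.pullback f ∈ I → f.1 x = 0) :
    ∃ y, φ.toFun y = x ∧ ∀ g ∈ I, g.1 y = 0 := by
  obtain ⟨Ψ, hΨ, hI⟩ := hfin.isIntegral.exists_extension_complex I (evalPoint x).toRingHom (by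
    intro f hf
    change ((f.1 x : ℝ) : ℂ) = 0
    rw [hx f hf, Complex.ofReal_zero])
  obtain ⟨y, hy, hyg⟩ := exists_point hY hN hfin hbir hΨ
  exact ⟨y, hy, fun g hg => by exact_mod_cast (hyg g).symm.trans (hI g hg)⟩

/-! ### The Zariski topology -/

theorem PolynomialMap.continuous_zariski (φ : PolynomialMap Y X) :
    @Continuous Y X (zariskiOn Y) (zariskiOn X) φ.toFun := by
  let _ := zariskiOn Y
  let _ := zariskiOn X
  refine continuous_iff_isClosed.2 fun S hS => isClosed_zariskiOn_iff.2 fun y hy => ?_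
  exact isClosed_zariskiOn_iff.1 hS _ fun f hf => hy (φ.pullback f) fun z hz => hf _ hz

/-- Closedness is the point: a zero of the contraction of `vanishingIdeal S` lifts to a zero of that
ideal, which lies in `S`. -/
theorem PolynomialMap.isHomeomorph_zariski (hY : IsAlgebraicSet Y)
    (hN : HasTotallyRealNormalization X) {φ : PolynomialMap Y X} (hfin : φ.IsFinite)
    (hbir : φ.IsBirational) (hbij : Function.Bijective φ.toFun) :
    @IsHomeomorph Y X (zariskiOn Y) (zariskiOn X) φ.toFun := by
  let _ := zariskiOn Y
  let _ := zariskiOn X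
  refine isHomeomorph_iff_continuous_isClosedMap_bijective.2
    ⟨φ.continuous_zariski, fun S hS => isClosed_zariskiOn_iff.2 fun x hx => ?_, hbij⟩
  obtain ⟨y, hy, hyS⟩ := exists_point_of_comap_le hY hN hfin hbir (vanishingIdeal S) (x := x)
    (fun f hf => hx f (by
      rintro _ ⟨z, hz, rfl⟩
      exact hf z hz))
  exact ⟨y, isClosed_zariskiOn_iff.1 hS y hyS, hy⟩

/-! ### The Euclidean topology -/

/-- Polynomial functions that are integral over those of the target are bounded on preimages of
compact sets. -/
theorem PolynomialMap.IsFinite.exists_bound {φ : PolynomialMap Y X} (hfin : φ.IsFinite)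
    (g : Pol Y) {K : Set X} (hK : IsCompact K) :
    ∃ C : ℝ, ∀ y, φ.toFun y ∈ K → |g.1 y| ≤ C := by
  obtain ⟨p, hp, hpg⟩ := hfin.isIntegral g
  have hb : ∀ k, ∃ C : ℝ, ∀ x ∈ K, |(p.coeff k).1 x| ≤ C := fun k => by
    obtain ⟨C, hC⟩ := hK.exists_bound_of_continuousOn (Pol.continuous (p.coeff k)).continuousOn
    exact ⟨C, hC⟩
  choose C hC using hb
  refine ⟨∑ k ∈ Finset.range p.natDegree, |C k| + 1, fun y hy => ?_⟩
  let ev : Pol X →+* ℝ :=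
    ((Pi.evalAlgHom ℝ (fun _ : X => ℝ) (φ.toFun y)).comp (Pol X).val).toRingHom
  let ev' : Pol Y →+* ℝ := ((Pi.evalAlgHom ℝ (fun _ : Y => ℝ) y).comp (Pol Y).val).toRingHom
  have hroot : (p.map ev).IsRoot (g.1 y) := by
    have h1 := congrArg ev' hpg
    rw [Polynomial.hom_eval₂, map_zero] at h1
    rw [Polynomial.IsRoot.def, Polynomial.eval_map]
    exact h1
  have hm := hp.map ev
  -- The Cauchy bound of a monic polynomial involves only its coefficients, which are bounded on
  -- `K`.
  have h1 := hroot.norm_lt_cauchyBound hm.ne_zero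
  have h2 : ((p.map ev).cauchyBound : ℝ) ≤ ∑ k ∈ Finset.range p.natDegree, |C k| + 1 := by
    rw [Polynomial.cauchyBound, hm.leadingCoeff, hp.natDegree_map]
    simp only [nnnorm_one, div_one, NNReal.coe_add, NNReal.coe_one, add_le_add_iff_right]
    have h3 : (Finset.range p.natDegree).sup (fun k => ‖(p.map ev).coeff k‖₊) ≤
        ∑ k ∈ Finset.range p.natDegree, ‖C k‖₊ := by
      refine Finset.sup_le fun k hk => le_trans ?_ (Finset.single_le_sum
        (f := fun k => ‖C k‖₊) (fun i _ => zero_le) hk)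
      rw [Polynomial.coeff_map, ← NNReal.coe_le_coe]
      exact (hC k _ hy).trans (le_abs_self _)
    have h4 := NNReal.coe_le_coe.2 h3
    rw [NNReal.coe_sum] at h4
    exact h4
  exact (NNReal.coe_lt_coe.2 h1).le.trans h2

/-- Integrality bounds the coordinates of `Y` over compact sets, so the map is proper, hence closed.
-/
theorem PolynomialMap.isHomeomorph (hX : IsAlgebraicSet X) (hY : IsAlgebraicSet Y)
    {φ : PolynomialMap Y X} (hfin : φ.IsFinite) (hbij : Function.Bijective φ.toFun) :
    IsHomeomorph φ.toFun := by
  have : LocallyCompactSpace X := hX.isClosed.isClosedEmbedding_subtypeVal.locallyCompactSpace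
  refine isHomeomorph_iff_continuous_isClosedMap_bijective.2 ⟨φ.continuous, ?_, hbij⟩
  refine (isProperMap_iff_isCompact_preimage.2 ⟨φ.continuous, fun K hK => ?_⟩).isClosedMap
  rw [Subtype.isCompact_iff]
  refine Metric.isCompact_of_isClosed_isBounded ?_ ?_
  · exact hY.isClosed.isClosedEmbedding_subtypeVal.isClosedMap _
      (hK.isClosed.preimage φ.continuous)
  · choose C hC using fun i => hfin.exists_bound (ofPoly Y (MvPolynomial.X i)) hK
    refine isBounded_iff_forall_norm_le.2 ⟨∑ i, |C i|, ?_⟩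
    rintro _ ⟨y, hy, rfl⟩
    refine (pi_norm_le_iff_of_nonneg (Finset.sum_nonneg fun i _ => abs_nonneg _)).2 fun i => ?_
    have h1 := hC i y hy
    rw [ofPoly_apply, MvPolynomial.eval_X] at h1
    exact (h1.trans (le_abs_self _)).trans (Finset.single_le_sum
      (f := fun k => |C k|) (fun i _ => abs_nonneg _) (Finset.mem_univ i))

/-! ### The constructible topology -/

theorem isConstructibleClosed_image_iff {φ : Y → X} (he : IsHomeomorph φ)
    (hz : @IsHomeomorph Y X (zariskiOn Y) (zariskiOn X) φ) (S : Set Y) :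
    IsConstructibleClosed S ↔ IsConstructibleClosed (φ '' S) := by
  have hinj := he.injective
  have hcz : ∀ T : Set Y, IsClosed[zariskiOn Y] T ↔ IsClosed[zariskiOn X] (φ '' T) := by
    let _ := zariskiOn Y
    let _ := zariskiOn X
    intro T
    exact hz.isClosedEmbedding.isClosed_iff_image_isClosed
  refine and_congr ⟨?_, ?_⟩ he.isClosedEmbedding.isClosed_iff_image_isClosed
  · rintro ⟨k, F, G, hF, hG, rfl⟩
    refine ⟨k, fun i => φ '' F i, fun i => φ '' G i, fun i => (hcz _).1 (hF i),
      fun i => (hcz _).1 (hG i), ?_⟩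
    rw [Set.image_iUnion]
    exact Set.iUnion_congr fun i => Set.image_sdiff hinj _ _
  · rintro ⟨k, F, G, hF, hG, h⟩
    have himg : ∀ T : Set X, φ '' (φ ⁻¹' T) = T := fun T =>
      Set.image_preimage_eq T he.surjective
    refine ⟨k, fun i => φ ⁻¹' F i, fun i => φ ⁻¹' G i,
      fun i => (hcz _).2 (by rw [himg]; exact hF i),
      fun i => (hcz _).2 (by rw [himg]; exact hG i), ?_⟩
    rw [← Set.preimage_image_eq S hinj, h, Set.preimage_iUnion]
    rfl

theorem isHomeomorph_constructibleOn {φ : Y → X} (hbij : Function.Bijective φ)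
    (h : ∀ S : Set Y, IsConstructibleClosed S ↔ IsConstructibleClosed (φ '' S)) :
    @IsHomeomorph Y X (constructibleOn Y) (constructibleOn X) φ := by
  let _ := constructibleOn Y
  let _ := constructibleOn X
  let e := Equiv.ofBijective φ hbij
  have h1 : Continuous e := continuous_generateFrom_iff.2 fun U hU => by
    refine TopologicalSpace.isOpen_generateFrom_of_mem ?_
    change IsConstructibleClosed (φ ⁻¹' Uᶜ)
    rw [h, Set.image_preimage_eq _ hbij.2]
    exact hU
  have h2 : Continuous e.symm := continuous_generateFrom_iff.2 fun U hU => by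
    refine TopologicalSpace.isOpen_generateFrom_of_mem ?_
    change IsConstructibleClosed (e.symm ⁻¹' Uᶜ)
    rw [← e.image_eq_preimage_symm]
    exact (h _).1 hU
  exact (Homeomorph.mk e h1 h2).isHomeomorph

end RealAlg
end

/-! ## Hereditary birationality and real prime ideals -/

noncomputable section

namespace RealAlg

variable {n m : ℕ} {X : Set (Fin n → ℝ)} {Y : Set (Fin m → ℝ)}

/-! ### Hereditary birationality -/

/-- The restriction of polynomial functions to a subset. -/
def Pol.restrict {X W : Set (Fin n → ℝ)} (h : W ⊆ X) : Pol X →+* Pol W where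
  toFun f := ⟨fun w => f.1 ⟨w.1, h w.2⟩, by
    obtain ⟨p, hp⟩ := mem_Pol_iff.1 f.2
    exact mem_Pol_iff.2 ⟨p, fun w => hp ⟨w.1, h w.2⟩⟩⟩
  map_one' := rfl
  map_mul' _ _ := rfl
  map_zero' := rfl
  map_add' _ _ := rfl

theorem Pol.restrict_surjective {X W : Set (Fin n → ℝ)} (h : W ⊆ X) :
    Function.Surjective (Pol.restrict h) := by
  intro f
  obtain ⟨p, rfl⟩ := ofPoly_surjective W f
  refine ⟨ofPoly X p, Pol.ext fun w => ?_⟩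
  rw [ofPoly_apply]
  exact ofPoly_apply X p _

theorem isAlgebraicSet_setOf_eval_eq_zero (p : MvPolynomial (Fin n) ℝ) :
    IsAlgebraicSet {x | MvPolynomial.eval x p = 0} :=
  ⟨{p}, by ext; simp [zeroSet]⟩

theorem IsIrreducibleAlgebraicSet.isDomain {W : Set (Fin n → ℝ)}
    (hW : IsIrreducibleAlgebraicSet W) : IsDomain (Pol W) := by
  let _ := zariski n
  obtain ⟨⟨w, hw⟩, hirr⟩ := hW.2
  have : Nontrivial (Pol W) := ⟨0, 1, fun h => by
    have := congrFun (congrArg Subtype.val h) ⟨w, hw⟩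
    exact zero_ne_one (α := ℝ) this⟩
  have : NoZeroDivisors (Pol W) := ⟨fun {f g} hfg => by
    obtain ⟨p, rfl⟩ := ofPoly_surjective W f
    obtain ⟨q, rfl⟩ := ofPoly_surjective W g
    have h := isPreirreducible_iff_isClosed_union_isClosed.1 hirr
      {x | MvPolynomial.eval x p = 0} {x | MvPolynomial.eval x q = 0}
      (isClosed_zariski_iff.2 (isAlgebraicSet_setOf_eval_eq_zero p))
      (isClosed_zariski_iff.2 (isAlgebraicSet_setOf_eval_eq_zero q)) (fun x hx => by
        have h1 := congrFun (congrArg Subtype.val hfg) ⟨x, hx⟩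
        rw [← map_mul, ofPoly_apply, map_mul] at h1
        exact mul_eq_zero.1 h1)
    refine h.imp (fun h => Pol.ext fun x => ?_) (fun h => Pol.ext fun x => ?_)
    · rw [ofPoly_apply]; exact h x.2
    · rw [ofPoly_apply]; exact h x.2⟩
  exact NoZeroDivisors.to_isDomain _

theorem PolynomialMap.imageClosure_subset (hX : IsAlgebraicSet X) (φ : PolynomialMap Y X)
    {W : Set (Fin m → ℝ)} (hW : W ⊆ Y) : φ.imageClosure hW ⊆ X := by
  let _ := zariski n
  refine closure_minimal ?_ (isClosed_zariski_iff.2 hX)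
  rintro _ ⟨w, rfl⟩
  exact (φ.toFun ⟨w.1, hW w.2⟩).2

/-- A polynomial vanishing on the image of `W` vanishes on its Zariski closure. -/
theorem PolynomialMap.restrict_pullback_injective (φ : PolynomialMap Y X)
    {W : Set (Fin m → ℝ)} (hW : W ⊆ Y) : Function.Injective (φ.restrict hW).pullback := by
  refine (injective_iff_map_eq_zero _).2 fun f hf => ?_
  obtain ⟨p, rfl⟩ := ofPoly_surjective _ f
  refine Pol.ext fun v => ?_
  rw [ofPoly_apply]
  let _ := zariski n
  have h := closure_minimal (s := Set.range fun w : W => (φ.toFun ⟨w.1, hW w.2⟩).1)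
    (t := {x | MvPolynomial.eval x p = 0}) (by
      rintro _ ⟨w, rfl⟩
      have h1 := congrFun (congrArg Subtype.val hf) w
      change (ofPoly _ p).1 ((φ.restrict hW).toFun w) = 0 at h1
      rwa [ofPoly_apply] at h1) (isClosed_zariski_iff.2 (isAlgebraicSet_setOf_eval_eq_zero p))
  exact h v.2

/-- A complex point of `W` over `v` is also one of `Y` over `v`, hence evaluation at a point of `Y`,
unique by injectivity. A `v` not known to lie in the image of `W` causes no harm, since only
uniqueness is needed. -/
theorem PolynomialMap.isHereditarilyBirational (hX : IsAlgebraicSet X) (hY : IsAlgebraicSet Y)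
    (hN : HasTotallyRealNormalization X) {φ : PolynomialMap Y X} (hfin : φ.IsFinite)
    (hbir : φ.IsBirational) (hinj : Function.Injective φ.toFun) :
    φ.IsHereditarilyBirational := by
  intro W hW hWirr
  have hVX := φ.imageClosure_subset hX hW
  set V := φ.imageClosure hW
  let f : Pol V →+* Pol W := (φ.restrict hW).pullback.toRingHom
  have hf : Function.Injective f := φ.restrict_pullback_injective hW
  have : IsDomain (Pol W) := hWirr.isDomain
  have : IsDomain (Pol V) := hf.isDomain f
  have hcomm : f.comp (Pol.restrict hVX) = (Pol.restrict hW).comp φ.pullback.toRingHom := rfl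
  have hint : f.IsIntegral := by
    refine RingHom.IsIntegral.tower_top (Pol.restrict hVX) f ?_
    rw [hcomm]
    exact RingHom.IsIntegral.trans _ _ hfin.isIntegral
      (RingHom.isIntegral_of_surjective _ (Pol.restrict_surjective hW))
  refine inducesFractionIso_of_forall_exists_mul_eq hf (hint.exists_mul_eq hf
    (fun v => (evalPoint v).toRingHom) (fun r hr => Pol.ext fun v => ?_) ?_)
  · have h1 : ((r.1 v : ℝ) : ℂ) = 0 := hr v
    exact_mod_cast h1
  · intro v Ψ₁ Ψ₂ h1 h2
    obtain ⟨y₁, hy₁, hg₁⟩ := exists_point hY hN hfin hbir (x := ⟨v.1, hVX v.2⟩)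
      (Ψ := Ψ₁.comp (Pol.restrict hW)) (fun g => h1 (Pol.restrict hVX g))
    obtain ⟨y₂, hy₂, hg₂⟩ := exists_point hY hN hfin hbir (x := ⟨v.1, hVX v.2⟩)
      (Ψ := Ψ₂.comp (Pol.restrict hW)) (fun g => h2 (Pol.restrict hVX g))
    have hy : y₁ = y₂ := hinj (hy₁.trans hy₂.symm)
    refine RingHom.ext fun b => ?_
    obtain ⟨g, rfl⟩ := Pol.restrict_surjective hW b
    exact (hg₁ g).trans (hy ▸ (hg₂ g).symm)

/-! ### Real prime ideals -/

theorem IsRealIdeal.comap {A B : Type*} [CommRing A] [CommRing B] {I : Ideal B}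
    (hI : IsRealIdeal I) (f : A →+* B) : IsRealIdeal (I.comap f) := by
  intro k a h i
  refine hI k (fun i => f (a i)) ?_ i
  simpa [Ideal.mem_comap] using h

theorem IsSumSq.exists_fin_sum {A B : Type*} [CommRing A] [CommRing B] {f : A →+* B}
    (hf : Function.Surjective f) {s : B} (hs : IsSumSq s) :
    ∃ (k : ℕ) (a : Fin k → A), f (∑ i, a i ^ 2) = s := by
  induction hs with
  | zero => exact ⟨0, Fin.elim0, by simp⟩
  | @sq_add x s hs ih =>
    obtain ⟨k, a, rfl⟩ := ih
    obtain ⟨b, rfl⟩ := hf x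
    refine ⟨k + 1, Fin.cons b a, ?_⟩
    rw [Fin.sum_univ_succ]
    simp [sq]

/-- The common denominator enters as a square, so the numerator stays a sum of squares. -/
theorem IsSumSq.exists_mul_sq_eq {D : Type*} [CommRing D] [IsDomain D] {z : FractionRing D}
    (hz : IsSumSq z) : ∃ s t : D, s ≠ 0 ∧ IsSumSq t ∧
      z * algebraMap D (FractionRing D) (s * s) = algebraMap D (FractionRing D) t := by
  induction hz with
  | zero => exact ⟨1, 0, one_ne_zero, .zero, by simp⟩
  | @sq_add x z hz ih =>
    obtain ⟨s, t, hs, ht, h⟩ := ih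
    obtain ⟨u, v, hv, rfl⟩ := IsFractionRing.div_surjective (A := D) x
    have hv0 := nonZeroDivisors.ne_zero hv
    have hv' : algebraMap D (FractionRing D) v ≠ 0 :=
      (map_ne_zero_iff _ (IsFractionRing.injective D (FractionRing D))).2 hv0
    refine ⟨s * v, u * s * (u * s) + v * v * t, mul_ne_zero hs hv0,
      .sq_add _ ((IsSumSq.mul_self v).mul ht), ?_⟩
    simp only [map_add, map_mul] at h ⊢
    rw [← h]
    field_simp

/-- The residue field of a real prime ideal is semireal. -/
theorem IsRealIdeal.not_isSumSq_neg_one {A : Type*} [CommRing A] {P : Ideal A} [P.IsPrime]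
    (hP : IsRealIdeal P) : ¬ IsSumSq (-1 : FractionRing (A ⧸ P)) := by
  intro h
  obtain ⟨s, t, hs, ht, hst⟩ := IsSumSq.exists_mul_sq_eq h
  have h0 : s * s + t = 0 := by
    apply IsFractionRing.injective (A ⧸ P) (FractionRing (A ⧸ P))
    rw [map_add, map_zero, ← hst]
    ring
  obtain ⟨b, rfl⟩ := Ideal.Quotient.mk_surjective s
  obtain ⟨k, a, rfl⟩ := IsSumSq.exists_fin_sum Ideal.Quotient.mk_surjective ht
  have h1 : ∑ i, (Fin.cons b a : Fin (k + 1) → A) i ^ 2 ∈ P := by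
    rw [Fin.sum_univ_succ, ← Ideal.Quotient.eq_zero_iff_mem]
    simpa [sq] using h0
  exact hs (Ideal.Quotient.eq_zero_iff_mem.2 (by simpa using hP _ _ h1 0))

/-- The homomorphism from a ring to the field of fractions of its quotient by an ideal. -/
def _root_.Ideal.toFractionRingQuotient {A : Type*} [CommRing A] (P : Ideal A) :
    A →+* FractionRing (A ⧸ P) :=
  (algebraMap (A ⧸ P) (FractionRing (A ⧸ P))).comp (Ideal.Quotient.mk P)

theorem _root_.Ideal.toFractionRingQuotient_eq_zero_iff {A : Type*} [CommRing A] (P : Ideal A)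
    {a : A} : P.toFractionRingQuotient a = 0 ↔ a ∈ P := by
  rw [← Ideal.Quotient.eq_zero_iff_mem]
  exact map_eq_zero_iff _ (IsFractionRing.injective (A ⧸ P) (FractionRing (A ⧸ P)))

/-- The real Nullstellensatz for prime ideals. -/
theorem exists_point_of_notMem (hX : IsAlgebraicSet X) {P : Ideal (Pol X)} [P.IsPrime]
    (hP : IsRealIdeal P) {f : Pol X} (hf : f ∉ P) :
    ∃ x : X, (∀ g ∈ P, g.1 x = 0) ∧ f.1 x ≠ 0 := by
  let F := FractionRing (Pol X ⧸ P)
  let g : MvPolynomial (Fin n) ℝ →+* F := P.toFractionRingQuotient.comp (ofPoly X).toRingHom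
  have hg : ∀ p, g p = 0 ↔ ofPoly X p ∈ P := fun p => P.toFractionRingQuotient_eq_zero_iff
  obtain ⟨q, rfl⟩ := ofPoly_surjective X f
  -- Specialization handles finitely many equations, so generators of the kernel stand for all of
  -- `P`.
  obtain ⟨T, hT⟩ := (RingHom.ker g).fg_of_isNoetherianRing
  obtain ⟨x, hx, hxq⟩ := exists_eval_eq_zero_and_ne_zero hP.not_isSumSq_neg_one g T {q}
    (fun p hp => by
      rw [← RingHom.mem_ker, ← hT]
      exact Ideal.subset_span hp)
    (fun p hp => by
      rw [Finset.mem_singleton.1 hp, Ne, hg]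
      exact hf)
  have hker : ∀ p, ofPoly X p ∈ P → MvPolynomial.eval x p = 0 := by
    intro p hp
    have h1 : p ∈ Ideal.span (T : Set (MvPolynomial (Fin n) ℝ)) := by
      rw [hT]
      exact (hg p).2 hp
    have h2 : Ideal.span (T : Set (MvPolynomial (Fin n) ℝ)) ≤
        RingHom.ker (MvPolynomial.eval x) := Ideal.span_le.2 hx
    exact h2 h1
  have hxX : x ∈ X := by
    obtain ⟨S, rfl⟩ := hX
    intro p hp
    refine hker p ?_
    have h0 : ofPoly (zeroSet S) p = 0 := Pol.ext fun z => by
      rw [ofPoly_apply]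
      exact z.2 p hp
    rw [h0]
    exact P.zero_mem
  refine ⟨⟨x, hxX⟩, fun r hr => ?_, ?_⟩
  · obtain ⟨p, rfl⟩ := ofPoly_surjective X r
    rw [ofPoly_apply]
    exact hker p hr
  · rw [ofPoly_apply]
    exact hxq q (Finset.mem_singleton_self q)

/-- A prime ideal over a real prime ideal is the vanishing ideal of the preimage of the zero
locus. -/
theorem PolynomialMap.eq_vanishingIdeal (hX : IsAlgebraicSet X) (hY : IsAlgebraicSet Y)
    (hN : HasTotallyRealNormalization X) {φ : PolynomialMap Y X} (hfin : φ.IsFinite)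
    (hbir : φ.IsBirational) (hbij : Function.Bijective φ.toFun) {P : Ideal (Pol X)} [P.IsPrime]
    (hP : IsRealIdeal P) {Q : Ideal (Pol Y)} [Q.IsPrime]
    (hQ : Q.comap φ.pullback.toRingHom = P) :
    Q = vanishingIdeal {y | ∀ f ∈ P, f.1 (φ.toFun y) = 0} := by
  set T : Set Y := {y | ∀ f ∈ P, f.1 (φ.toFun y) = 0}
  have hmem : ∀ f, φ.pullback f ∈ Q ↔ f ∈ P := fun f => by rw [← hQ]; rfl
  have hle : Q ≤ vanishingIdeal T := by
    intro g hg y hy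
    obtain ⟨z, hz, hzQ⟩ := exists_point_of_comap_le hY hN hfin hbir Q (x := φ.toFun y)
      (fun f hf => hy f ((hmem f).1 hf))
    rw [← hbij.1 hz]
    exact hzQ g hg
  refine le_antisymm hle fun b hb => ?_
  by_contra hbQ
  let _ := φ.pullback.toRingHom.toAlgebra
  -- Incomparability: a strictly larger ideal would contract to a strictly larger one, but by the
  -- real Nullstellensatz the vanishing ideal contracts into `P`.
  have hlt := Ideal.comap_lt_comap_of_integral_mem_sdiff (R := Pol X) hle ⟨hb, hbQ⟩
    (hfin.isIntegral b)
  refine hlt.not_ge fun f hf => (hmem f).2 ?_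
  by_contra hfP
  obtain ⟨x, hx, hxf⟩ := exists_point_of_notMem hX hP hfP
  obtain ⟨y, rfl⟩ := hbij.2 x
  exact hxf (hf y hx)

/-- Injectivity and reality of the lifted prime both come from `eq_vanishingIdeal`; existence of a
prime above is lying over. -/
theorem PolynomialMap.bijOn_realSpec (hX : IsAlgebraicSet X) (hY : IsAlgebraicSet Y)
    (hN : HasTotallyRealNormalization X) {φ : PolynomialMap Y X} (hfin : φ.IsFinite)
    (hbir : φ.IsBirational) (hbij : Function.Bijective φ.toFun) :
    Set.BijOn (PrimeSpectrum.comap φ.pullback.toRingHom) (realSpec (Pol Y)) (realSpec (Pol X)) := by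
  refine ⟨fun q hq => IsRealIdeal.comap hq _, fun q₁ hq₁ q₂ hq₂ h => ?_, fun p hp => ?_⟩
  · have hp : IsRealIdeal (q₂.asIdeal.comap φ.pullback.toRingHom) := IsRealIdeal.comap hq₂ _
    have h' : q₁.asIdeal.comap φ.pullback.toRingHom = q₂.asIdeal.comap φ.pullback.toRingHom :=
      congrArg PrimeSpectrum.asIdeal h
    exact PrimeSpectrum.ext ((eq_vanishingIdeal hX hY hN hfin hbir hbij hp h').trans
      (eq_vanishingIdeal hX hY hN hfin hbir hbij hp rfl).symm)
  · let _ := φ.pullback.toRingHom.toAlgebra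
    have : Algebra.IsIntegral (Pol X) (Pol Y) := ⟨hfin.isIntegral⟩
    obtain ⟨Q, -, hQ, hQp⟩ := Ideal.exists_ideal_over_prime_of_isIntegral (S := Pol Y) p.asIdeal ⊥
      (by
        intro f hf
        have : φ.pullback f = 0 := hf
        rw [map_eq_zero_iff _ (φ.pullback_injective hbij.2)] at this
        rw [this]
        exact p.asIdeal.zero_mem)
    refine ⟨⟨Q, hQ⟩, ?_, PrimeSpectrum.ext hQp⟩
    change IsRealIdeal Q
    rw [eq_vanishingIdeal hX hY hN hfin hbir hbij hp hQp]
    exact isRealIdeal_vanishingIdeal _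

end RealAlg

end
-- The third conjunct concerns the Euclidean closed constructible sets themselves, so nothing
-- depends on whether they exhaust the closed sets of the topology they generate.
theorem mainTheorem4 {n m : ℕ} (X : Set (Fin n → ℝ)) (Y : Set (Fin m → ℝ))
    (hX : RealAlg.IsAlgebraicSet X) (hY : RealAlg.IsAlgebraicSet Y)
    (hN : RealAlg.HasTotallyRealNormalization X)
    (φ : RealAlg.PolynomialMap Y X) (hfin : φ.IsFinite) (hbir : φ.IsBirational)
    (hbij : Function.Bijective φ.toFun) :
    IsHomeomorph φ.toFun ∧
    @IsHomeomorph Y X (RealAlg.constructibleOn Y) (RealAlg.constructibleOn X) φ.toFun ∧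
    (∀ S : Set Y,
      RealAlg.IsConstructibleClosed S ↔ RealAlg.IsConstructibleClosed (φ.toFun '' S)) ∧
    @IsHomeomorph Y X (RealAlg.zariskiOn Y) (RealAlg.zariskiOn X) φ.toFun ∧
    Set.BijOn (PrimeSpectrum.comap φ.pullback.toRingHom)
      (RealAlg.realSpec (RealAlg.Pol Y)) (RealAlg.realSpec (RealAlg.Pol X)) ∧
    φ.IsHereditarilyBirational := by
  have he := RealAlg.PolynomialMap.isHomeomorph hX hY hfin hbij
  have hz := RealAlg.PolynomialMap.isHomeomorph_zariski hY hN hfin hbir hbij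
  have hc := RealAlg.isConstructibleClosed_image_iff he hz
  exact ⟨he, RealAlg.isHomeomorph_constructibleOn hbij hc, hc, hz,
    RealAlg.PolynomialMap.bijOn_realSpec hX hY hN hfin hbir hbij,
    RealAlg.PolynomialMap.isHereditarilyBirational hX hY hN hfin hbir hbij.1⟩
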